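/- Let $n\ge 1$ and let $\mathfrak S_n$ be the symmetric group with simple transpositions $s_i=(i,i+1)$, $i\in[n-1]$, and length function $\ell$; products are compositions. Put $\mathrm{Des}_L(\gamma)=\{i:\ell(s_i\gamma)<\ell(\gamma)\}$ and $\mathrm{Des}_R(\gamma)=\{i:\ell(\gamma s_i)<\ell(\gamma)\}$. The left (resp. right) weak Bruhat order $\preceq_L$ (resp. $\preceq_R$) is the partial order with covering relations $\gamma\prec s_i\gamma$ for $i\notin \mathrm{Des}_L(\gamma)$ (resp. $\gamma\prec\gamma s_i$ for $i\notin\mathrm{Des}_R(\gamma)$), and $[\sigma,\rho]_L=\{\gamma:\sigma\preceq_L\gamma\preceq_L\rho\}$ for $\sigma\preceq_L\rho$. For $S\subseteq[n-1]$ let $S^{c}=[n-1]\setminus S$, let $w_0(S)$ be the longest element of the subgroup generated by $\{s_i: i\in S\}$, let $w_0=w_0([n-1])$, and let $w_1(S)$ be the longest element of $\{z:\mathrm{Des}_R(z)\subseteq S\}$, the set of minimal length representatives of the left cosets of the subgroup generated by $\{s_i:i\in S^c\}$. Two nonempty left weak Bruhat intervals are equivalent if there is an isomorphism between them, as posets under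 $\preceq_L$, that preserves $\mathrm{Des}_L$. Each equivalence class $C$ is ordered by $[\sigma,\rho]_L\preceq[\sigma',\rho']_L$ if and only if $\sigma\preceq_R\sigma'$; $\min C$ and $\max C$ denote the least and the greatest element of $C$. For a partial order $P$ on $[n]$ let $\Sigma_L(P)=\{\gamma\in\mathfrak S_n:\gamma(i)\le\gamma(j)\text{ whenever } i\preceq_P j\}$. Diagrams are finite sets of boxes $(x,y)$ with $x,y\ge1$, where $x$ is the column counted from the left and $y$ the row counted from the bottom. Let $\mathfrak D_n$ be the set of diagrams with $n$ boxes whose sets of occupied columns and rows are $\{1,\dots,c\}$ and $\{1,\dots,r\}$ for some $c,r$. A standard filling $F$ of $D\in\mathfrak D_n$ places each of $1,\dots,n$ in exactly one box; $P_F$ is the partial order on $[n]$ in which $i\preceq j$ if and only if the box of $i$ is weakly left of and weakly below the box of $j$. Let $F_D^{\downarrow}$ be the filling with $1,\dots,n$ placed in order down each column, starting with the leftmost column. Define $Z_0=F_D^{\downarrow},Z_1,\dots,Z_n$ as follows. Call an entry $x>i$ of $Z_{i-1}$ admissible if (i) $x$ lies strictly above and strictly to the right of $i$, and (ii) every $j\in\{i,i+1,\dots,x-1\}$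 lies strictly below and weakly to the left of $x$ and is not covered by $x$ in $P_{Z_{i-1}}$. If there are admissible entries, let $\mathbf x$ be the uppermost one, and obtain $Z_i$ from $Z_{i-1}$ by increasing each of the entries $i,\dots,\mathbf x-1$ by $1$ and replacing the entry $\mathbf x$ by $i$; otherwise $Z_i=Z_{i-1}$. Put $F_D^{\nearrow}=Z_n$. For $D$ with $r$ rows and $c$ columns let $D^*=\{(r-y+1,c-x+1):(x,y)\in D\}$, and for a standard filling $F$ of $D$ let $F^*$ be the standard filling of $D^*$ in which the box $(r-y+1,c-x+1)$ contains the entry $F(x,y)$. For $S\subseteq[n-1]$ and $w_0(S)\preceq_L\rho$ write $S^c=\{z_1<\dots<z_p\}$, $z_0=0$, $z_{p+1}=n$, and $\mathrm{Des}_L(\rho)=\{q_1<\dots<q_e\}$, $q_0=0$, $q_{e+1}=n$; put $X_i=\{\rho(k):z_{i-1}<k\le z_i\}$, $Y_j=\{k:q_{j-1}<k\le q_j\}$ and $D_{S;\rho}=\{(i,j):X_i\cap Y_j\neq\emptyset\}$. For $\sigma\preceq_L w_1(S)$ put $D_{\sigma;S}=(D_{S^c;w_0\sigma})^*$ and $F_{D_{\sigma;S}}^{\swarrow}=\bigl(F_{D_{S^c;w_0\sigma}}^{\nearrow}\bigr)^*$.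 **Theorem.** Let $S\subseteq[n-1]$ and let $\rho,\sigma\in\mathfrak S_n$ satisfy $w_0(S)\preceq_L\rho$ and $\sigma\preceq_L w_1(S)$. Let $C_{S;\rho}$ and $C_{\sigma;S}$ be the equivalence classes of $[w_0(S),\rho]_L$ and $[\sigma,w_1(S)]_L$. Then $D_{S;\rho}$ and $D_{S^c;w_0\sigma}$ belong to $\mathfrak D_n$, the sets $\Sigma_L(P_F)$ below are left weak Bruhat intervals, and (a) $\min C_{S;\rho}=[w_0(S),\rho]_L$ and $\max C_{S;\rho}=\Sigma_L\bigl(P_{F^{\nearrow}_{D_{S;\rho}}}\bigr)$; (b) $\min C_{\sigma;S}=\Sigma_L\bigl(P_{F^{\swarrow}_{D_{\sigma;S}}}\bigr)$ and $\max C_{\sigma;S}=[\sigma,w_1(S)]_L$. -/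

import Mathlib

/-!
Conventions. Throughout, the symmetric group on `[n + 1]` is `Equiv.Perm (Fin (n + 1))`, where
`Fin (n + 1)` is `{0, ..., n}` in place of `[n + 1] = {1, ..., n + 1}` and `Fin n` is
`{0, ..., n - 1}` in place of the index set `[n]` of the simple transpositions. Products of
permutations are compositions. Boxes of diagrams have coordinates `(column, row)` starting at
`(1, 1)`, columns being counted from the left and rows from the bottom.
-/

namespace WeakBruhat

/-! ### The symmetric group and its weak orders -/

section WeakOrders

variable {n : ℕ}

/-- The simple transposition exchanging `i` and `i + 1`. -/
def simpleTransp (i : Fin n) : Equiv.Perm (Fin (n + 1)) :=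
  Equiv.swap i.castSucc i.succ

/-- The length of `σ`: the least number of factors in an expression of `σ` as a product of
simple transpositions. -/
noncomputable def len (σ : Equiv.Perm (Fin (n + 1))) : ℕ :=
  sInf {k | ∃ w : List (Fin n), w.length = k ∧ (w.map simpleTransp).prod = σ}

/-- The left descent set. -/
def desL (σ : Equiv.Perm (Fin (n + 1))) : Set (Fin n) :=
  {i | len (simpleTransp i * σ) < len σ}

/-- The right descent set. -/
def desR (σ : Equiv.Perm (Fin (n + 1))) : Set (Fin n) :=
  {i | len (σ * simpleTransp i) < len σ}

/-- The covering relation of the left weak order. -/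
def leftWeakCov (σ τ : Equiv.Perm (Fin (n + 1))) : Prop :=
  ∃ i : Fin n, i ∉ desL σ ∧ τ = simpleTransp i * σ

/-- The covering relation of the right weak order. -/
def rightWeakCov (σ τ : Equiv.Perm (Fin (n + 1))) : Prop :=
  ∃ i : Fin n, i ∉ desR σ ∧ τ = σ * simpleTransp i

/-- The left weak order `σ ≼_L τ`. -/
def leftWeakLE : Equiv.Perm (Fin (n + 1)) → Equiv.Perm (Fin (n + 1)) → Prop :=
  Relation.ReflTransGen leftWeakCov

/-- The right weak order `σ ≼_R τ`. -/
def rightWeakLE : Equiv.Perm (Fin (n + 1)) → Equiv.Perm (Fin (n + 1)) → Prop :=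
  Relation.ReflTransGen rightWeakCov

theorem exists_longest {A : Set (Equiv.Perm (Fin (n + 1)))} (hA : A.Nonempty) :
    ∃ w ∈ A, ∀ u ∈ A, len u ≤ len w :=
  Set.exists_max_image A len (Set.toFinite A) hA

/-- An element of maximal length of a nonempty set of permutations. (In the two uses below,
parabolic subgroups and sets of minimal coset representatives, it is unique.) -/
noncomputable def longest (A : Set (Equiv.Perm (Fin (n + 1)))) (hA : A.Nonempty) :
    Equiv.Perm (Fin (n + 1)) :=
  (exists_longest hA).choose

/-- The parabolic subgroup generated by the simple transpositions with index in `S`. -/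
def parabolic (S : Set (Fin n)) : Subgroup (Equiv.Perm (Fin (n + 1))) :=
  Subgroup.closure (simpleTransp '' S)

/-- `w₀(S)`: the longest element of the parabolic subgroup of `S`. -/
noncomputable def w0 (S : Set (Fin n)) : Equiv.Perm (Fin (n + 1)) :=
  longest (parabolic S : Set (Equiv.Perm (Fin (n + 1)))) ⟨1, one_mem _⟩

/-- The minimal length representatives of the left cosets of the parabolic subgroup of `S`. -/
def minReps (S : Set (Fin n)) : Set (Equiv.Perm (Fin (n + 1))) :=
  {z | desR z ⊆ Sᶜ}

theorem len_one : len (1 : Equiv.Perm (Fin (n + 1))) = 0 :=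
  Nat.sInf_eq_zero.2 (Or.inl ⟨[], rfl, rfl⟩)

theorem one_mem_minReps (S : Set (Fin n)) : (1 : Equiv.Perm (Fin (n + 1))) ∈ minReps S := by
  intro i hi
  have hi' : len (1 * simpleTransp i) < len (1 : Equiv.Perm (Fin (n + 1))) := hi
  rw [len_one] at hi'
  exact absurd hi' (Nat.not_lt_zero _)

/-- `w₁(S)`: the longest element among the minimal length representatives of the left cosets of
the parabolic subgroup of the complement of `S`. -/
noncomputable def w1 (S : Set (Fin n)) : Equiv.Perm (Fin (n + 1)) :=
  longest (minReps Sᶜ) ⟨1, one_mem_minReps _⟩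

end WeakOrders

/-! ### Left weak Bruhat intervals, their equivalence classes and the order on a class -/

/-- A nonempty left weak Bruhat interval `[bot, top]_L`. -/
@[ext]
structure WeakInterval (n : ℕ) where
  /-- the least element -/
  bot : Equiv.Perm (Fin (n + 1))
  /-- the greatest element -/
  top : Equiv.Perm (Fin (n + 1))
  le : leftWeakLE bot top

namespace WeakInterval

variable {n : ℕ}

/-- The set of permutations in the interval. -/
def carrier (I : WeakInterval n) : Set (Equiv.Perm (Fin (n + 1))) :=
  {γ | leftWeakLE I.bot γ ∧ leftWeakLE γ I.top}

/-- There is a poset isomorphism between the intervals (with the left weak order) that preserves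
left descent sets. -/
def DescentEquiv (I J : WeakInterval n) : Prop :=
  ∃ f : I.carrier ≃ J.carrier,
    (∀ γ δ : I.carrier, leftWeakLE (f γ : Equiv.Perm (Fin (n + 1))) (f δ) ↔
      leftWeakLE (γ : Equiv.Perm (Fin (n + 1))) δ) ∧
    ∀ γ : I.carrier, desL (γ : Equiv.Perm (Fin (n + 1))) = desL (f γ : Equiv.Perm (Fin (n + 1)))

/-- The equivalence class of an interval. -/
def eqClass (I : WeakInterval n) : Set (WeakInterval n) :=
  {J | DescentEquiv I J}

/-- `[σ, ρ]_L ≼ [σ', ρ']_L` if and only if `σ ≼_R σ'`. This is only a preorder on the set of all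
intervals; it is used on equivalence classes. -/
instance : Preorder (WeakInterval n) where
  le I J := rightWeakLE I.bot J.bot
  le_refl _ := Relation.ReflTransGen.refl
  le_trans _ _ _ h₁ h₂ := Relation.ReflTransGen.trans h₁ h₂

end WeakInterval

/-- `Σ_L(P)` for a partial order `P` on the ground set. -/
def linExt {n : ℕ} (P : PartialOrder (Fin (n + 1))) : Set (Equiv.Perm (Fin (n + 1))) :=
  {σ | ∀ i j, P.le i j → σ i ≤ σ j}

/-! ### Diagrams and standard fillings -/

/-- The number of columns of a diagram. -/
def numCols (D : Finset (ℕ × ℕ)) : ℕ := (D.image Prod.fst).card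

/-- The number of rows of a diagram. -/
def numRows (D : Finset (ℕ × ℕ)) : ℕ := (D.image Prod.snd).card

/-- `D` has `N` boxes, and it has no empty rows or columns in its smallest enclosing rectangle,
whose lower left box is `(1, 1)`. -/
structure IsDiagram (N : ℕ) (D : Finset (ℕ × ℕ)) : Prop where
  card_eq : D.card = N
  cols : D.image Prod.fst = Finset.Icc 1 (numCols D)
  rows : D.image Prod.snd = Finset.Icc 1 (numRows D)

/-- A standard filling of `D`: every one of the `N` entries occurs in exactly one box. -/
abbrev Filling (D : Finset (ℕ × ℕ)) (N : ℕ) : Type := {p : ℕ × ℕ // p ∈ D} ≃ Fin N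

section Fillings

variable {D : Finset (ℕ × ℕ)} {N : ℕ}

/-- The box `(column, row)` containing the entry `i`. -/
def Filling.pos (F : Filling D N) (i : Fin N) : ℕ × ℕ := (F.symm i : ℕ × ℕ)

theorem Filling.pos_injective (F : Filling D N) : Function.Injective F.pos :=
  Subtype.val_injective.comp F.symm.injective

/-- The poset `P_F`: `i ≼ j` if and only if the box of `i` is weakly to the left of and weakly
below the box of `j` (the order of `ℕ × ℕ` is componentwise). -/
@[reducible] def Filling.poset (F : Filling D N) : PartialOrder (Fin N) :=
  PartialOrder.lift F.pos F.pos_injective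

/-- The boxes of `ℕ × ℕ`, ordered by columns from left to right, and from top to bottom within
a column. -/
def columnReading : ℕ × ℕ ↪ ℕ ×ₗ ℕᵒᵈ where
  toFun p := toLex (p.1, OrderDual.toDual p.2)
  inj' _ _ h := h

/-- The filling `F_D^↓`: the entries are placed in increasing order down each column, starting
from the leftmost column. -/
noncomputable def fillDown (D : Finset (ℕ × ℕ)) (hD : D.card = N) : Filling D N :=
  (Equiv.ofBijective
    (fun p : {p : ℕ × ℕ // p ∈ D} =>
      (⟨columnReading p, Finset.mem_map_of_mem _ p.2⟩ :
        {q : ℕ ×ₗ ℕᵒᵈ // q ∈ D.map columnReading}))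
    ⟨fun p q h => Subtype.ext (columnReading.injective (Subtype.mk.inj h)), fun q => by
      obtain ⟨p, hp, hq⟩ := Finset.mem_map.1 q.2
      exact ⟨⟨p, hp⟩, Subtype.ext hq⟩⟩).trans
  ((D.map columnReading).orderIsoOfFin ((Finset.card_map _).trans hD)).symm.toEquiv

/-- The conditions on an entry `x > i` in the `i`-th step of the relabeling procedure:
`x` lies strictly above and strictly to the right of `i`, and each entry `j = i, ..., x - 1` lies
strictly below and weakly to the left of `x` and is not covered by `x` in `P_Z`. -/
def Admissible (Z : Filling D N) (i x : Fin N) : Prop :=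
  i < x ∧ (Z.pos i).1 < (Z.pos x).1 ∧ (Z.pos i).2 < (Z.pos x).2 ∧
    ∀ j, i ≤ j → j < x →
      (Z.pos j).2 < (Z.pos x).2 ∧ (Z.pos j).1 ≤ (Z.pos x).1 ∧
        ¬ @CovBy (Fin N) Z.poset.toLT j x

theorem exists_uppermost (Z : Filling D N) (i : Fin N) (h : {x | Admissible Z i x}.Nonempty) :
    ∃ x ∈ {x | Admissible Z i x}, ∀ y ∈ {x | Admissible Z i x}, (Z.pos y).2 ≤ (Z.pos x).2 :=
  Set.exists_max_image _ (fun x => (Z.pos x).2) (Set.toFinite _) h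

open Classical in
/-- The `i`-th step of the relabeling procedure. If there is an admissible entry, let `x` be the
uppermost one (no two admissible entries lie in the same row); the entries `i, ..., x - 1` are
incremented by `1` and the entry `x` becomes `i`. Otherwise nothing changes. Here
`Fin.cycleIcc i x` is the cycle `i ↦ i + 1 ↦ ... ↦ x ↦ i`. -/
noncomputable def relabelStep (Z : Filling D N) (i : Fin N) : Filling D N :=
  if h : {x | Admissible Z i x}.Nonempty then
    Z.trans (Fin.cycleIcc i (exists_uppermost Z i h).choose)
  else Z

/-- The filling `F_D^↗`: the result of the steps for all entries `i`, in increasing order,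
starting from `F_D^↓`. -/
noncomputable def fillNE (D : Finset (ℕ × ℕ)) (hD : D.card = N) : Filling D N :=
  (List.finRange N).foldl relabelStep (fillDown D hD)

/-- The reflection of the boxes of `D` across an antidiagonal,
`(i, j) ↦ (r - j + 1, c - i + 1)` where `D` has `r` rows and `c` columns. -/
def starBox (D : Finset (ℕ × ℕ)) (p : ℕ × ℕ) : ℕ × ℕ :=
  (numRows D - p.2 + 1, numCols D - p.1 + 1)

/-- The diagram `D^*`. -/
def starDiagram (D : Finset (ℕ × ℕ)) : Finset (ℕ × ℕ) := D.image (starBox D)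

theorem starBox_injOn (hD : IsDiagram N D) {p q : ℕ × ℕ} (hp : p ∈ D) (hq : q ∈ D)
    (h : starBox D p = starBox D q) : p = q := by
  have h1 : ∀ z ∈ D, z.1 ≤ numCols D := fun z hz => by
    have := Finset.mem_image_of_mem Prod.fst hz
    rw [hD.cols] at this
    exact (Finset.mem_Icc.1 this).2
  have h2 : ∀ z ∈ D, z.2 ≤ numRows D := fun z hz => by
    have := Finset.mem_image_of_mem Prod.snd hz
    rw [hD.rows] at this
    exact (Finset.mem_Icc.1 this).2
  have hp1 := h1 p hp
  have hq1 := h1 q hq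
  have hp2 := h2 p hp
  have hq2 := h2 q hq
  simp only [starBox, Prod.mk.injEq] at h
  ext <;> omega

/-- The bijection from the boxes of `D` to the boxes of `D^*`. -/
noncomputable def starEquiv (hD : IsDiagram N D) :
    {p : ℕ × ℕ // p ∈ D} ≃ {p : ℕ × ℕ // p ∈ starDiagram D} :=
  Equiv.ofBijective (fun p => ⟨starBox D p, Finset.mem_image_of_mem _ p.2⟩)
    ⟨fun p q h => Subtype.ext (starBox_injOn hD p.2 q.2 (Subtype.mk.inj h)), fun q => by
      obtain ⟨p, hp, hq⟩ := Finset.mem_image.1 q.2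
      exact ⟨⟨p, hp⟩, Subtype.ext hq⟩⟩

/-- The filling `F^*` of `D^*`: the reflected box contains the same entry. -/
noncomputable def Filling.star (hD : IsDiagram N D) (F : Filling D N) :
    Filling (starDiagram D) N :=
  (starEquiv hD).symm.trans F

end Fillings

/-! ### The diagram of a lower descent interval -/

section DiagramOfInterval

variable {n : ℕ}

open Classical in
/-- For a set of cuts `A = {a₁ < ... < a_p}` (in `{1, ..., n}`), the number `k` with
`a_{k-1} + 1 ≤ r ≤ a_k`, where `a₀ = 0` and `a_{p+1} = n + 1`. -/
noncomputable def blockIndex (A : Set (Fin n)) (r : Fin (n + 1)) : ℕ :=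
  (Finset.univ.filter fun a : Fin n => a ∈ A ∧ a.castSucc < r).card + 1

/-- The set `X_i(S; ρ)` of the values of `ρ` on the `i`-th block cut out by the complement
of `S`. -/
def blockX (S : Set (Fin n)) (ρ : Equiv.Perm (Fin (n + 1))) (i : ℕ) : Set (Fin (n + 1)) :=
  {c | ∃ r, blockIndex Sᶜ r = i ∧ c = ρ r}

/-- The `j`-th block `Y_j(ρ)` cut out by the left descents of `ρ`. -/
def blockY (ρ : Equiv.Perm (Fin (n + 1))) (j : ℕ) : Set (Fin (n + 1)) :=
  {c | blockIndex (desL ρ) c = j}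

open Classical in
/-- The diagram `D_{S;ρ}`: the boxes `(i, j)` such that `X_i(S; ρ)` meets `Y_j(ρ)`. -/
noncomputable def lowerDiagram (S : Set (Fin n)) (ρ : Equiv.Perm (Fin (n + 1))) :
    Finset (ℕ × ℕ) :=
  (Finset.Icc 1 (n + 1) ×ˢ Finset.Icc 1 (n + 1)).filter fun p =>
    (blockX S ρ p.1 ∩ blockY ρ p.2).Nonempty

end DiagramOfInterval

end WeakBruhat

/-!
A left weak interval `[σ, ρ]_L` is the set of linear extensions of the poset on positions in which
`a` is below `b` when both `σ` and `ρ` increase from `a` to `b` (`WeakInterval.mem_carrier_iff`).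
A cover `γ ≺ s_i γ` creates the left descent `i` and no other one, so a descent-preserving
isomorphism respects the indices of covers and must be right multiplication by a fixed permutation,
that is, a renaming `π` of the positions (`WeakInterval.DescentEquiv.exists_isRelabeling`).
Such a renaming preserves left descent sets if and only if it preserves the relative order of any
two positions that are consecutive in some linear extension; these are the pairs which are
incomparable or form a cover of the poset (`WeakInterval.exists_mem_carrier_succ`). The order on
the class compares the inversions of the labelings at the remaining pairs.

For `[w₀(S), ρ]_L` the positions are the boxes of `D_{S;ρ}`, read down the columns, and the poset is
the componentwise order (`boxOf_lt_iff`). Hence the class consists of the fillings that order each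
pair of `Adjacent` boxes (incomparable, or one covering the other) as the column reading does, and
thereby all pairs in the transitive closure `Forced`. In particular the order within rows and within
columns is forced, so the column reading itself is the least element. The filling that keeps the
forced inequalities and reverses all other pairs would clearly be the greatest element; what has to
be seen is that this relation `Precedes` is transitive. This holds because a forced inequality
between `a` and `b` splits at every box `c` that is read in between (`Forced.split`): otherwise `c`
would lie strictly inside the rectangle spanned by one step of a chain of adjacent boxes from `a` to
`b`.

The procedure defining `F^↗` is a selection sort for `Precedes`. At every step the remaining entries
are in column reading order, an admissible entry precedes all remaining entries read before it, and
the first remaining entry for `Precedes` is itself admissible unless it is already in place; it is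
therefore the uppermost admissible entry (`IsPartialSort.relabelStep_eq`).

The second half follows by duality: `γ ↦ w₀ γ` is an anti-automorphism of the left weak order which
takes `[σ, w₁(S)]_L` to `[w₀(Sᶜ), w₀ σ]_L`, reverses the order on equivalence classes
(`WeakInterval.dual_le_dual`), and corresponds to the reflection of diagrams across an antidiagonal
(`mem_linExt_star_iff`).
-/

namespace WeakBruhat

/-! ### Inversions, length and the weak orders -/

section Inversions

variable {n : ℕ} {σ τ : Equiv.Perm (Fin (n + 1))} {i : Fin n}

theorem perm_inv_apply {α : Type*} (σ : Equiv.Perm α) (x : α) : σ⁻¹ (σ x) = x :=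
  σ.symm_apply_apply x

theorem perm_apply_inv {α : Type*} (σ : Equiv.Perm α) (x : α) : σ (σ⁻¹ x) = x :=
  σ.apply_symm_apply x

/-- The inversions of `σ`, as pairs of positions. -/
def inversions (σ : Equiv.Perm (Fin (n + 1))) : Finset (Fin (n + 1) × Fin (n + 1)) :=
  Finset.univ.filter fun p => p.1 < p.2 ∧ σ p.2 < σ p.1

theorem mem_inversions {a b : Fin (n + 1)} :
    (a, b) ∈ inversions σ ↔ a < b ∧ σ b < σ a := by
  simp [inversions]

theorem inversions_subset_iff :
    inversions σ ⊆ inversions τ ↔ ∀ a b, a < b → σ b < σ a → τ b < τ a := by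
  constructor
  · intro h a b hab hs
    exact (mem_inversions.1 (h (mem_inversions.2 ⟨hab, hs⟩))).2
  · rintro h ⟨a, b⟩ hp
    obtain ⟨hab, hs⟩ := mem_inversions.1 hp
    exact mem_inversions.2 ⟨hab, h a b hab hs⟩

theorem eq_one_of_strictMono {N : ℕ} {σ : Equiv.Perm (Fin N)} (h : StrictMono σ) : σ = 1 := by
  have h1 : (σ : Fin N → Fin N) = id :=
    (h.range_inj strictMono_id).1 (by rw [σ.surjective.range_eq, Set.range_id])
  ext x
  simp [h1]

theorem simpleTransp_mul_self (i : Fin n) : simpleTransp i * simpleTransp i = 1 :=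
  Equiv.swap_mul_self _ _

theorem simpleTransp_mul_cancel (i : Fin n) (σ : Equiv.Perm (Fin (n + 1))) :
    simpleTransp i * (simpleTransp i * σ) = σ := by
  rw [← mul_assoc, simpleTransp_mul_self, one_mul]

theorem simpleTransp_inv (i : Fin n) : (simpleTransp i)⁻¹ = simpleTransp i :=
  Equiv.swap_inv _ _

theorem simpleTransp_lt_iff (x y : Fin (n + 1)) :
    simpleTransp i x < simpleTransp i y ↔
      (x < y ∧ ¬ (x = i.castSucc ∧ y = i.succ)) ∨ (x = i.succ ∧ y = i.castSucc) := by
  simp only [simpleTransp, Equiv.swap_apply_def]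
  split_ifs <;> simp only [Fin.lt_def, Fin.ext_iff, Fin.val_castSucc, Fin.val_succ] at * <;> omega

/-- Left multiplication by `s_i` exchanges the values `i` and `i + 1`; if they occur in increasing
order, this creates exactly one inversion. -/
theorem inversions_simpleTransp_mul (h : σ⁻¹ i.castSucc < σ⁻¹ i.succ) :
    inversions (simpleTransp i * σ) =
      insert (σ⁻¹ i.castSucc, σ⁻¹ i.succ) (inversions σ) := by
  ext ⟨a, b⟩
  simp only [Finset.mem_insert, mem_inversions, Prod.mk.injEq, Equiv.Perm.mul_apply,
    simpleTransp_lt_iff, Equiv.Perm.eq_inv_iff_eq]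
  constructor
  · rintro ⟨hab, ⟨h1, -⟩ | ⟨h1, h2⟩⟩
    · exact Or.inr ⟨hab, h1⟩
    · exact Or.inl ⟨h2, h1⟩
  · rintro (⟨h1, h2⟩ | ⟨h1, h2⟩)
    · rw [← h1, ← h2] at h
      simp only [perm_inv_apply] at h
      exact ⟨h, Or.inr ⟨h2, h1⟩⟩
    · refine ⟨h1, Or.inl ⟨h2, ?_⟩⟩
      rintro ⟨h3, h4⟩
      rw [← h3, ← h4] at h
      simp only [perm_inv_apply] at h
      exact lt_asymm h h1

theorem card_inversions_of_lt (h : σ⁻¹ i.castSucc < σ⁻¹ i.succ) :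
    (inversions (simpleTransp i * σ)).card = (inversions σ).card + 1 := by
  rw [inversions_simpleTransp_mul h, Finset.card_insert_of_notMem]
  rw [mem_inversions]
  rintro ⟨-, h2⟩
  simp only [perm_apply_inv] at h2
  exact absurd h2 (Fin.castSucc_lt_succ).le.not_gt

theorem card_inversions_of_gt (h : σ⁻¹ i.succ < σ⁻¹ i.castSucc) :
    (inversions (simpleTransp i * σ)).card + 1 = (inversions σ).card := by
  rw [← card_inversions_of_lt (i := i), simpleTransp_mul_cancel]
  simpa [simpleTransp] using h

theorem inv_castSucc_lt_or_gt (σ : Equiv.Perm (Fin (n + 1))) (i : Fin n) :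
    σ⁻¹ i.castSucc < σ⁻¹ i.succ ∨ σ⁻¹ i.succ < σ⁻¹ i.castSucc :=
  lt_or_gt_of_ne fun h => (Fin.castSucc_lt_succ (i := i)).ne (σ⁻¹.injective h)

theorem card_inversions_prod_le (w : List (Fin n)) :
    (inversions (w.map simpleTransp).prod).card ≤ w.length := by
  induction w with
  | nil =>
    rw [List.map_nil, List.prod_nil, List.length_nil, Nat.le_zero, Finset.card_eq_zero]
    refine Finset.eq_empty_of_forall_notMem ?_
    rintro ⟨a, b⟩ h
    obtain ⟨h1, h2⟩ := mem_inversions.1 h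
    exact lt_asymm h1 h2
  | cons i w ih =>
    rw [List.map_cons, List.prod_cons, List.length_cons]
    rcases inv_castSucc_lt_or_gt (w.map simpleTransp).prod i with h | h
    · rw [card_inversions_of_lt h]
      omega
    · have := card_inversions_of_gt h
      omega

/-- Sorting by descents writes `σ` as a product of as many simple transpositions as it has
inversions. -/
theorem exists_word (σ : Equiv.Perm (Fin (n + 1))) :
    ∃ w : List (Fin n), w.length = (inversions σ).card ∧ (w.map simpleTransp).prod = σ := by
  induction h : (inversions σ).card using Nat.strong_induction_on generalizing σ with
  | _ k ih =>
    by_cases hi : ∃ i : Fin n, σ⁻¹ i.succ < σ⁻¹ i.castSucc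
    · obtain ⟨i, hi⟩ := hi
      have hc := card_inversions_of_gt hi
      obtain ⟨w, hw, hp⟩ := ih _ (by omega) (simpleTransp i * σ) rfl
      refine ⟨i :: w, by rw [List.length_cons]; omega, ?_⟩
      rw [List.map_cons, List.prod_cons, hp, simpleTransp_mul_cancel]
    · have h1 : σ⁻¹ = 1 := eq_one_of_strictMono <| Fin.strictMono_iff_lt_succ.2 fun i =>
        (inv_castSucc_lt_or_gt σ i).resolve_right fun hg => hi ⟨i, hg⟩
      rw [inv_eq_one] at h1
      subst h1
      have := card_inversions_prod_le (n := n) []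
      rw [List.map_nil, List.prod_nil, List.length_nil, Nat.le_zero] at this
      exact ⟨[], by rw [← h, this, List.length_nil], rfl⟩

theorem len_eq_card_inversions (σ : Equiv.Perm (Fin (n + 1))) :
    len σ = (inversions σ).card := by
  apply le_antisymm
  · exact Nat.sInf_le (exists_word σ)
  · obtain ⟨w, hw, hp⟩ := Nat.sInf_mem (s := {k | ∃ w : List (Fin n), w.length = k ∧
      (w.map simpleTransp).prod = σ}) ⟨_, exists_word σ⟩
    rw [len, ← hw, ← hp]
    exact card_inversions_prod_le w

theorem mem_desL : i ∈ desL σ ↔ σ⁻¹ i.succ < σ⁻¹ i.castSucc := by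
  change len _ < len _ ↔ _
  rw [len_eq_card_inversions, len_eq_card_inversions]
  rcases inv_castSucc_lt_or_gt σ i with h | h
  · rw [card_inversions_of_lt h]
    exact iff_of_false (by omega) h.not_gt
  · have := card_inversions_of_gt h
    exact iff_of_true (by omega) h

theorem notMem_desL : i ∉ desL σ ↔ σ⁻¹ i.castSucc < σ⁻¹ i.succ := by
  rw [mem_desL]
  exact ⟨(inv_castSucc_lt_or_gt σ i).resolve_right, fun h => h.not_gt⟩

theorem len_inv (σ : Equiv.Perm (Fin (n + 1))) : len σ⁻¹ = len σ := by
  rw [len_eq_card_inversions, len_eq_card_inversions]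
  refine Finset.card_nbij' (fun p => (σ⁻¹ p.2, σ⁻¹ p.1)) (fun p => (σ p.2, σ p.1)) ?_ ?_ ?_ ?_
  · rintro ⟨a, b⟩ h
    obtain ⟨h1, h2⟩ := mem_inversions.1 h
    exact mem_inversions.2 ⟨h2, by simpa only [perm_apply_inv] using h1⟩
  · rintro ⟨a, b⟩ h
    obtain ⟨h1, h2⟩ := mem_inversions.1 h
    exact mem_inversions.2 ⟨h2, by simpa only [perm_inv_apply] using h1⟩
  · rintro ⟨a, b⟩ -
    simp only [perm_apply_inv]
  · rintro ⟨a, b⟩ -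
    simp only [perm_inv_apply]

theorem mem_desR_iff_mem_desL_inv : i ∈ desR σ ↔ i ∈ desL σ⁻¹ := by
  change len _ < len _ ↔ len _ < len _
  rw [len_inv σ, ← len_inv (σ * _), mul_inv_rev, simpleTransp_inv]

theorem mem_desR : i ∈ desR σ ↔ σ i.succ < σ i.castSucc := by
  rw [mem_desR_iff_mem_desL_inv, mem_desL, inv_inv]

/-- A permutation whose inversions lie among those of `τ`, other than `τ` itself, is covered by
a permutation with the same property. -/
theorem exists_cov_of_inversions_subset (h : inversions σ ⊆ inversions τ) (hne : σ ≠ τ) :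
    ∃ i : Fin n, i ∉ desL σ ∧ inversions (simpleTransp i * σ) ⊆ inversions τ := by
  by_contra! hcon
  refine hne (mul_inv_eq_one.1 (eq_one_of_strictMono (σ := τ * σ⁻¹) ?_)).symm
  refine Fin.strictMono_iff_lt_succ.2 fun i => ?_
  rw [inversions_subset_iff] at h
  simp only [Equiv.Perm.mul_apply]
  rcases inv_castSucc_lt_or_gt σ i with hi | hi
  · refine lt_of_not_ge fun hge => hcon i (notMem_desL.2 hi) ?_
    rw [inversions_simpleTransp_mul hi, Finset.insert_subset_iff, inversions_subset_iff]
    refine ⟨mem_inversions.2 ⟨hi, lt_of_le_of_ne hge fun he => ?_⟩, h⟩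
    exact hi.ne' (τ.injective he)
  · exact h _ _ hi (by simpa only [perm_apply_inv] using Fin.castSucc_lt_succ)

theorem leftWeakLE_iff_inversions_subset :
    leftWeakLE σ τ ↔ inversions σ ⊆ inversions τ := by
  constructor
  · intro h
    induction h with
    | refl => exact subset_rfl
    | tail _ h ih =>
      obtain ⟨i, hi, rfl⟩ := h
      rw [inversions_simpleTransp_mul (notMem_desL.1 hi)]
      exact ih.trans (Finset.subset_insert _ _)
  · intro h
    induction hk : (inversions τ).card - (inversions σ).card using Nat.strong_induction_on
      generalizing σ with
    | _ k ih =>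
      by_cases hne : σ = τ
      · rw [hne]
        exact Relation.ReflTransGen.refl
      · obtain ⟨i, hi, hs⟩ := exists_cov_of_inversions_subset h hne
        have h1 := card_inversions_of_lt (notMem_desL.1 hi)
        have h2 := Finset.card_le_card hs
        exact Relation.ReflTransGen.head ⟨i, hi, rfl⟩ (ih _ (by omega) hs rfl)

theorem leftWeakLE_iff :
    leftWeakLE σ τ ↔ ∀ a b, a < b → σ b < σ a → τ b < τ a :=
  leftWeakLE_iff_inversions_subset.trans inversions_subset_iff

theorem rightWeakLE_iff : rightWeakLE σ τ ↔ leftWeakLE σ⁻¹ τ⁻¹ := by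
  constructor
  · intro h
    induction h with
    | refl => exact Relation.ReflTransGen.refl
    | tail _ h ih =>
      obtain ⟨i, hi, rfl⟩ := h
      refine ih.tail ⟨i, by rwa [← mem_desR_iff_mem_desL_inv], ?_⟩
      rw [mul_inv_rev, simpleTransp_inv]
  · intro h
    suffices ∀ x, leftWeakLE σ⁻¹ x → rightWeakLE σ x⁻¹ by
      simpa only [inv_inv] using this _ h
    intro x h
    induction h with
    | refl => rw [inv_inv]; exact Relation.ReflTransGen.refl
    | tail _ h ih =>
      obtain ⟨i, hi, rfl⟩ := h
      refine ih.tail ⟨i, by rwa [mem_desR_iff_mem_desL_inv, inv_inv], ?_⟩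
      rw [mul_inv_rev, simpleTransp_inv]

theorem eq_of_leftWeakLE_of_card_le (h : leftWeakLE σ τ)
    (hc : (inversions τ).card ≤ (inversions σ).card) : σ = τ := by
  rw [leftWeakLE_iff_inversions_subset] at h
  by_contra hne
  obtain ⟨i, hi, hs⟩ := exists_cov_of_inversions_subset h hne
  have h1 := card_inversions_of_lt (notMem_desL.1 hi)
  have h2 := Finset.card_le_card hs
  omega

theorem leftWeakLE_antisymm (h : leftWeakLE σ τ) (h' : leftWeakLE τ σ) : σ = τ :=
  eq_of_leftWeakLE_of_card_le h
    (Finset.card_le_card (leftWeakLE_iff_inversions_subset.1 h'))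

theorem leftWeakLE_trans {υ : Equiv.Perm (Fin (n + 1))} (h : leftWeakLE σ τ)
    (h' : leftWeakLE τ υ) : leftWeakLE σ υ :=
  Relation.ReflTransGen.trans h h'

/-- The index of a cover of the left weak order is the only descent that it creates. -/
theorem eq_of_mem_desL_simpleTransp_mul {j : Fin n} (hi : i ∉ desL σ)
    (hj : j ∈ desL (simpleTransp i * σ)) (hj' : j ∉ desL σ) : j = i := by
  rw [notMem_desL] at hi hj'
  rw [mem_desL, mul_inv_rev, simpleTransp_inv, Equiv.Perm.mul_apply, Equiv.Perm.mul_apply] at hj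
  by_contra hne
  have hne' : j.val ≠ i.val := fun h => hne (Fin.ext h)
  by_cases h1 : j.succ = i.castSucc
  · have h2 : simpleTransp i j.castSucc = j.castSucc := by
      refine Equiv.swap_apply_of_ne_of_ne ?_ ?_ <;>
        simp only [ne_eq, Fin.ext_iff, Fin.val_castSucc, Fin.val_succ] at * <;> omega
    rw [h1, h2, simpleTransp, Equiv.swap_apply_left] at hj
    rw [h1] at hj'
    exact lt_asymm hj (hj'.trans hi)
  · by_cases h3 : j.castSucc = i.succ
    · have h2 : simpleTransp i j.succ = j.succ := by
        refine Equiv.swap_apply_of_ne_of_ne ?_ ?_ <;>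
          simp only [ne_eq, Fin.ext_iff, Fin.val_castSucc, Fin.val_succ] at * <;> omega
      rw [h3, h2, simpleTransp, Equiv.swap_apply_right] at hj
      rw [h3] at hj'
      exact lt_asymm hj (hi.trans hj')
    · rw [simpleTransp, Equiv.swap_apply_of_ne_of_ne, Equiv.swap_apply_of_ne_of_ne] at hj
      · exact lt_asymm hj hj'
      all_goals
        simp only [ne_eq, Fin.ext_iff, Fin.val_castSucc, Fin.val_succ] at *
        omega

end Inversions

/-! ### Intervals and their equivalence classes -/

section Intervals

variable {n : ℕ}

/-- A left weak interval is the set of linear extensions of the intersection of the two linear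
orders given by its endpoints. -/
theorem WeakInterval.mem_carrier_iff (I : WeakInterval n) (γ : Equiv.Perm (Fin (n + 1))) :
    γ ∈ I.carrier ↔ ∀ a b, I.bot a < I.bot b → I.top a < I.top b → γ a < γ b := by
  have hI := leftWeakLE_iff.1 I.le
  change leftWeakLE _ _ ∧ leftWeakLE _ _ ↔ _
  rw [leftWeakLE_iff, leftWeakLE_iff]
  constructor
  · rintro ⟨h1, h2⟩ a b hab hab'
    rcases lt_trichotomy a b with h | h | h
    · refine lt_of_not_ge fun hge => ?_
      exact lt_asymm hab' (h2 a b h (lt_of_le_of_ne hge fun he => h.ne' (γ.injective he)))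
    · exact absurd hab (by rw [h]; exact lt_irrefl _)
    · exact h1 b a h hab
  · intro h
    refine ⟨fun a b hab h1 => h b a h1 (hI a b hab h1), fun a b hab h1 => ?_⟩
    refine lt_of_not_ge fun hge => lt_asymm h1 (h a b ?_ (lt_of_le_of_ne hge ?_))
    · refine lt_of_not_ge fun hge' => ?_
      exact hge.not_gt (hI a b hab (lt_of_le_of_ne hge' fun he => hab.ne' (I.bot.injective he)))
    · exact fun he => hab.ne (I.top.injective he)

/-- Two positions that are incomparable in the poset of an interval are in increasing order in the
least element. -/
theorem WeakInterval.lt_of_bot_lt_of_top_gt (I : WeakInterval n) {a b : Fin (n + 1)}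
    (h : I.bot a < I.bot b) (h' : I.top b < I.top a) : a < b := by
  refine lt_of_not_ge fun hge => ?_
  rcases hge.lt_or_eq with hlt | rfl
  · exact lt_asymm h' (leftWeakLE_iff.1 I.le b a hlt h)
  · exact lt_irrefl _ h

/-- Members of an interval differ only in the order of positions that are incomparable in the poset
of the interval, so only these have to be compared. -/
theorem WeakInterval.leftWeakLE_iff (I : WeakInterval n) {γ δ : Equiv.Perm (Fin (n + 1))}
    (hγ : γ ∈ I.carrier) (hδ : δ ∈ I.carrier) :
    leftWeakLE γ δ ↔
      ∀ a b, I.bot a < I.bot b → I.top b < I.top a → γ b < γ a → δ b < δ a := by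
  rw [I.mem_carrier_iff] at hγ hδ
  rw [WeakBruhat.leftWeakLE_iff]
  constructor
  · exact fun h a b h1 h2 => h a b (I.lt_of_bot_lt_of_top_gt h1 h2)
  · intro h a b hab h1
    have hne : a ≠ b := hab.ne
    rcases lt_or_gt_of_ne (I.bot.injective.ne hne) with h2 | h2 <;>
      rcases lt_or_gt_of_ne (I.top.injective.ne hne) with h3 | h3
    · exact absurd (hγ a b h2 h3) h1.not_gt
    · exact h a b h2 h3 h1
    · exact absurd (I.lt_of_bot_lt_of_top_gt h2 h3) hab.not_gt
    · exact hδ b a h2 h3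

theorem WeakInterval.bot_mem (I : WeakInterval n) : I.bot ∈ I.carrier :=
  ⟨Relation.ReflTransGen.refl, I.le⟩

theorem WeakInterval.top_mem (I : WeakInterval n) : I.top ∈ I.carrier :=
  ⟨I.le, Relation.ReflTransGen.refl⟩

/-- `J` is obtained from `I` by renaming the positions along `π`, and this renaming preserves the
left descent sets of the members. -/
structure WeakInterval.IsRelabeling (π : Equiv.Perm (Fin (n + 1))) (I J : WeakInterval n) :
    Prop where
  bot_eq : J.bot = I.bot * π⁻¹
  top_eq : J.top = I.top * π⁻¹
  desL_eq : ∀ γ ∈ I.carrier, desL γ = desL (γ * π⁻¹)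

namespace WeakInterval.IsRelabeling

variable {π : Equiv.Perm (Fin (n + 1))} {I J : WeakInterval n}

theorem bot_apply (h : IsRelabeling π I J) (a : Fin (n + 1)) : J.bot (π a) = I.bot a := by
  rw [h.bot_eq, Equiv.Perm.mul_apply, perm_inv_apply]

theorem top_apply (h : IsRelabeling π I J) (a : Fin (n + 1)) : J.top (π a) = I.top a := by
  rw [h.top_eq, Equiv.Perm.mul_apply, perm_inv_apply]

theorem lt_of_bot_lt_of_top_gt (h : IsRelabeling π I J) {a b : Fin (n + 1)}
    (h1 : I.bot a < I.bot b) (h2 : I.top b < I.top a) : π a < π b := by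
  apply J.lt_of_bot_lt_of_top_gt
  · rwa [h.bot_apply, h.bot_apply]
  · rwa [h.top_apply, h.top_apply]

theorem mul_inv_mem_iff (h : IsRelabeling π I J) (γ : Equiv.Perm (Fin (n + 1))) :
    γ * π⁻¹ ∈ J.carrier ↔ γ ∈ I.carrier := by
  rw [I.mem_carrier_iff, J.mem_carrier_iff]
  constructor
  · intro hγ a b h1 h2
    have := hγ (π a) (π b) (by rwa [h.bot_apply, h.bot_apply])
      (by rwa [h.top_apply, h.top_apply])
    simpa only [Equiv.Perm.mul_apply, perm_inv_apply] using this
  · intro hγ a b h1 h2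
    rw [h.bot_eq] at h1
    rw [h.top_eq] at h2
    exact hγ _ _ h1 h2

/-- A relabeling is an isomorphism because the pairs compared in `WeakInterval.leftWeakLE_iff` keep
their relative order under `π`. -/
theorem descentEquiv (h : IsRelabeling π I J) : DescentEquiv I J := by
  refine ⟨(Equiv.mulRight π⁻¹).subtypeEquiv fun γ => (h.mul_inv_mem_iff γ).symm, ?_, ?_⟩
  · rintro ⟨γ, hγ⟩ ⟨δ, hδ⟩
    change leftWeakLE (γ * π⁻¹) (δ * π⁻¹) ↔ leftWeakLE γ δ
    rw [I.leftWeakLE_iff hγ hδ,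
      J.leftWeakLE_iff ((h.mul_inv_mem_iff γ).2 hγ) ((h.mul_inv_mem_iff δ).2 hδ),
      ← π.forall_congr_right]
    refine forall_congr' fun a => ?_
    rw [← π.forall_congr_right]
    refine forall_congr' fun b => ?_
    simp only [h.bot_apply, h.top_apply, Equiv.Perm.mul_apply, perm_inv_apply]
  · rintro ⟨γ, hγ⟩
    exact h.desL_eq γ hγ

/-- Adjacent positions of a member of the interval are in the same relative order after the
renaming. -/
theorem lt_iff_of_succ (h : IsRelabeling π I J) {γ : Equiv.Perm (Fin (n + 1))}
    (hγ : γ ∈ I.carrier) {a b : Fin (n + 1)} (hab : (γ b : ℕ) = γ a + 1) :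
    π a < π b ↔ a < b := by
  obtain ⟨i, hi⟩ : ∃ i : Fin n, i.castSucc = γ a :=
    ⟨⟨γ a, by have := (γ b).2; omega⟩, rfl⟩
  have hi' : i.succ = γ b := by
    rw [Fin.ext_iff, hab, ← hi, Fin.val_succ, Fin.val_castSucc]
  have key := congrArg (i ∈ ·) (h.desL_eq γ hγ)
  simp only [mem_desL, mul_inv_rev, inv_inv, Equiv.Perm.mul_apply, hi, hi', perm_inv_apply,
    eq_iff_iff] at key
  have hne : a ≠ b := by
    rintro rfl
    omega
  have hne' := π.injective.ne hne
  constructor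
  · exact fun h1 => (lt_or_gt_of_ne hne).resolve_right fun h2 => lt_asymm h1 (key.1 h2)
  · exact fun h1 => (lt_or_gt_of_ne hne').resolve_right fun h2 => lt_asymm h1 (key.2 h2)

end WeakInterval.IsRelabeling

/-- An interval whose endpoints arise by renaming the positions is a relabeling as soon as the
renaming respects the order of all positions that are adjacent in some member. -/
theorem WeakInterval.isRelabeling_of_lt_iff {π : Equiv.Perm (Fin (n + 1))} {I J : WeakInterval n}
    (hb : J.bot = I.bot * π⁻¹) (ht : J.top = I.top * π⁻¹)
    (h : ∀ γ ∈ I.carrier, ∀ a b, (γ b : ℕ) = γ a + 1 → (π a < π b ↔ a < b)) :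
    IsRelabeling π I J where
  bot_eq := hb
  top_eq := ht
  desL_eq γ hγ := by
    ext i
    rw [← not_iff_not, notMem_desL, notMem_desL, mul_inv_rev, inv_inv, Equiv.Perm.mul_apply,
      Equiv.Perm.mul_apply]
    refine (h γ hγ _ _ ?_).symm
    rw [perm_apply_inv, perm_apply_inv, Fin.val_succ, Fin.val_castSucc]

/-- A descent-preserving isomorphism preserves the index of every cover, so it is multiplication
on the right by a fixed permutation. -/
theorem WeakInterval.DescentEquiv.exists_isRelabeling {I J : WeakInterval n}
    (h : DescentEquiv I J) : ∃ π, IsRelabeling π I J := by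
  obtain ⟨f, hf, hd⟩ := h
  obtain ⟨π, hπ⟩ : ∃ π : Equiv.Perm (Fin (n + 1)), J.bot = I.bot * π⁻¹ :=
    ⟨J.bot⁻¹ * I.bot, by rw [mul_inv_rev, inv_inv, mul_inv_cancel_left]⟩
  have hbot : (f ⟨I.bot, I.bot_mem⟩ : Equiv.Perm (Fin (n + 1))) = J.bot := by
    refine leftWeakLE_antisymm ?_ (f ⟨I.bot, I.bot_mem⟩).2.1
    have := (hf ⟨I.bot, I.bot_mem⟩ (f.symm ⟨J.bot, J.bot_mem⟩)).2
      (f.symm ⟨J.bot, J.bot_mem⟩).2.1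
    rwa [Equiv.apply_symm_apply] at this
  have htop : (f ⟨I.top, I.top_mem⟩ : Equiv.Perm (Fin (n + 1))) = J.top := by
    refine leftWeakLE_antisymm (f ⟨I.top, I.top_mem⟩).2.2 ?_
    have := (hf (f.symm ⟨J.top, J.top_mem⟩) ⟨I.top, I.top_mem⟩).2
      (f.symm ⟨J.top, J.top_mem⟩).2.2
    rwa [Equiv.apply_symm_apply] at this
  have key : ∀ γ (_ : leftWeakLE I.bot γ) (hγ : γ ∈ I.carrier),
      (f ⟨γ, hγ⟩ : Equiv.Perm (Fin (n + 1))) = γ * π⁻¹ := by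
    intro γ hle
    induction hle with
    | refl => exact fun _ => hbot.trans hπ
    | @tail γ' γ hle hcov ih =>
      intro hγ
      have hle' : leftWeakLE γ' γ := Relation.ReflTransGen.single hcov
      obtain ⟨i, hi, rfl⟩ := hcov
      have hγ' : γ' ∈ I.carrier := ⟨hle, leftWeakLE_trans hle' hγ.2⟩
      have hγf := ih hγ'
      have hcard := card_inversions_of_lt (notMem_desL.1 hi)
      have hne : (⟨γ', hγ'⟩ : I.carrier) ≠ ⟨_, hγ⟩ := by
        intro he
        have he' : γ' = simpleTransp i * γ' := congrArg Subtype.val he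
        rw [← he'] at hcard
        omega
      have hlef := (hf ⟨γ', hγ'⟩ ⟨_, hγ⟩).2 hle'
      rcases Relation.ReflTransGen.cases_head hlef with he | ⟨x, ⟨j, hj, rfl⟩, hle2⟩
      · exact absurd (f.injective (Subtype.ext he)) hne
      -- The first step `x` of a chain from `f γ'` to `f γ` is the image of some `δ` with
      -- `γ' ≺ δ ≼ γ`, and this forces `δ = γ`.
      set x := simpleTransp j * (f ⟨γ', hγ'⟩ : Equiv.Perm (Fin (n + 1))) with hx
      have hlex : leftWeakLE (f ⟨γ', hγ'⟩ : Equiv.Perm (Fin (n + 1))) x :=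
        Relation.ReflTransGen.single ⟨j, hj, hx⟩
      have hxJ : x ∈ J.carrier :=
        ⟨leftWeakLE_trans (f ⟨γ', hγ'⟩).2.1 hlex, leftWeakLE_trans hle2 (f ⟨_, hγ⟩).2.2⟩
      have hcardx := card_inversions_of_lt (notMem_desL.1 hj)
      rw [← hx] at hcardx
      obtain ⟨⟨δ, hδ⟩, hδx⟩ := f.surjective ⟨x, hxJ⟩
      have hδx' : (f ⟨δ, hδ⟩ : Equiv.Perm (Fin (n + 1))) = x := congrArg Subtype.val hδx
      have h1 : leftWeakLE γ' δ := (hf ⟨γ', hγ'⟩ ⟨δ, hδ⟩).1 (by rw [hδx']; exact hlex)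
      have h2 : leftWeakLE δ (simpleTransp i * γ') :=
        (hf ⟨δ, hδ⟩ ⟨_, hγ⟩).1 (by rw [hδx']; exact hle2)
      have h3 : δ = simpleTransp i * γ' := by
        refine eq_of_leftWeakLE_of_card_le h2 ?_
        by_contra hlt
        have h4 : γ' = δ := eq_of_leftWeakLE_of_card_le h1 (by omega)
        subst h4
        rw [hδx'] at hcardx
        omega
      subst h3
      have hji : j = i := by
        refine eq_of_mem_desL_simpleTransp_mul hi ?_ ?_
        · have h4 := hd ⟨_, hδ⟩
          rw [hδx'] at h4
          change desL (simpleTransp i * γ') = _ at h4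
          rw [h4, hx, mem_desL, mul_inv_rev, simpleTransp_inv, Equiv.Perm.mul_apply,
            Equiv.Perm.mul_apply, simpleTransp, Equiv.swap_apply_left, Equiv.swap_apply_right]
          exact notMem_desL.1 hj
        · have h4 := hd ⟨γ', hγ'⟩
          change desL γ' = _ at h4
          rwa [h4]
      rw [hδx', hx, hγf, hji, mul_assoc]
  refine ⟨π, hπ, ?_, fun γ hγ => ?_⟩
  · rw [← htop, key _ I.le]
  · have h1 := hd ⟨γ, hγ⟩
    rwa [key γ hγ.1] at h1

/-- The members of an equivalence class are the relabelings of any one of them. -/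
theorem WeakInterval.mem_eqClass_iff {I J : WeakInterval n} :
    J ∈ I.eqClass ↔ ∃ π, IsRelabeling π I J :=
  ⟨fun h => DescentEquiv.exists_isRelabeling h, fun ⟨_, h⟩ => h.descentEquiv⟩

theorem WeakInterval.isRelabeling_one (I : WeakInterval n) : IsRelabeling 1 I I :=
  ⟨by simp, by simp, by simp⟩

theorem WeakInterval.self_mem_eqClass (I : WeakInterval n) : I ∈ I.eqClass :=
  mem_eqClass_iff.2 ⟨1, I.isRelabeling_one⟩

/-- The order on an equivalence class: only pairs of positions that are comparable in the poset of
the interval matter. -/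
theorem WeakInterval.IsRelabeling.le_iff {π₁ π₂ : Equiv.Perm (Fin (n + 1))}
    {I J₁ J₂ : WeakInterval n} (h₁ : IsRelabeling π₁ I J₁) (h₂ : IsRelabeling π₂ I J₂) :
    J₁ ≤ J₂ ↔ ∀ a b, I.bot a < I.bot b → I.top a < I.top b → π₁ b < π₁ a → π₂ b < π₂ a := by
  change rightWeakLE J₁.bot J₂.bot ↔ _
  rw [rightWeakLE_iff, WeakBruhat.leftWeakLE_iff, h₁.bot_eq, h₂.bot_eq]
  simp only [mul_inv_rev, inv_inv, Equiv.Perm.mul_apply]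
  constructor
  · intro h a b hab _ hlt
    have := h _ _ hab
    simp only [perm_inv_apply] at this
    exact this hlt
  · intro h x y hxy hlt
    refine h (I.bot⁻¹ x) (I.bot⁻¹ y) (by simpa only [perm_apply_inv] using hxy) ?_ hlt
    refine lt_of_not_ge fun hge => ?_
    refine lt_asymm hlt (h₁.lt_of_bot_lt_of_top_gt (by simpa only [perm_apply_inv] using hxy)
      (lt_of_le_of_ne hge fun he => ?_))
    exact hxy.ne' (I.bot⁻¹.injective (I.top.injective he))

end Intervals

/-! ### Forced inequalities between the boxes of a diagram -/

section Boxes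

variable {N : ℕ}

/-- A strict total order on `Fin N` is the pullback of the standard one along a permutation. -/
theorem exists_perm_lt_iff (r : Fin N → Fin N → Prop) (hirr : ∀ a, ¬ r a a)
    (htrans : ∀ a b c, r a b → r b c → r a c) (htot : ∀ a b, a ≠ b → r a b ∨ r b a) :
    ∃ π : Equiv.Perm (Fin N), ∀ a b, π a < π b ↔ r a b := by
  classical
  let f : Fin N → Fin N := fun a => ⟨(Finset.univ.filter fun z => r z a).card, by
    have := Finset.card_lt_univ_of_notMem (s := Finset.univ.filter fun z => r z a) (x := a)
      (by simp [hirr])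
    simpa using this⟩
  have hf : ∀ a b, r a b → f a < f b := fun a b hab => by
    change (Finset.univ.filter fun z => r z a).card < (Finset.univ.filter fun z => r z b).card
    refine Finset.card_lt_card (Finset.ssubset_iff_subset_ne.2 ⟨?_, ?_⟩)
    · intro z hz
      simp only [Finset.mem_filter, Finset.mem_univ, true_and] at hz ⊢
      exact htrans z a b hz hab
    · intro he
      have h1 : a ∈ Finset.univ.filter fun z => r z b := by simp [hab]
      rw [← he] at h1
      simp [hirr] at h1
  have hinj : Function.Injective f := fun a b hab => by
    by_contra hne
    rcases htot a b hne with h | h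
    · exact (hf a b h).ne hab
    · exact (hf b a h).ne' hab
  refine ⟨Equiv.ofBijective f (Finite.injective_iff_bijective.1 hinj), fun a b => ⟨fun h => ?_,
    hf a b⟩⟩
  rcases eq_or_ne a b with rfl | hne
  · exact absurd h (lt_irrefl _)
  · exact (htot a b hne).resolve_right fun h' => lt_asymm h (hf b a h')

/-- The boxes `β 0, β 1, ...` are listed down the columns, starting from the leftmost column. -/
def IsColumnReading (β : Fin N → ℕ × ℕ) : Prop :=
  ∀ a b, a < b ↔ (β a).1 < (β b).1 ∨ ((β a).1 = (β b).1 ∧ (β b).2 < (β a).2)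

/-- `a` is read before `b`, and no box lies strictly between the two boxes in the componentwise
order, so they are incomparable or one covers the other. -/
def Adjacent (β : Fin N → ℕ × ℕ) (a b : Fin N) : Prop :=
  a < b ∧ ∀ c, ¬ (β a < β c ∧ β c < β b) ∧ ¬ (β b < β c ∧ β c < β a)

/-- The transitive closure of `Adjacent`: the inequalities that hold in all fillings which order
adjacent boxes as the column reading does. -/
def Forced (β : Fin N → ℕ × ℕ) : Fin N → Fin N → Prop :=
  Relation.TransGen (Adjacent β)

/-- The order which agrees with the column reading on the forced pairs and reverses it on all other
pairs. -/
def Precedes (β : Fin N → ℕ × ℕ) (a b : Fin N) : Prop :=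
  Forced β a b ∨ (b < a ∧ ¬ Forced β b a)

variable {β : Fin N → ℕ × ℕ} {a b c : Fin N}

theorem Forced.lt (h : Forced β a b) : a < b := by
  induction h with
  | single h => exact h.1
  | tail _ h ih => exact ih.trans h.1

/-- Inequalities along weakly descending pairs are forced. -/
theorem forced_of_snd_le (hβ : IsColumnReading β) (hab : a < b) (hle : (β b).2 ≤ (β a).2) :
    Forced β a b := by
  induction hk : (b : ℕ) - a using Nat.strong_induction_on generalizing a b with
  | _ k ih =>
    by_cases hadj : Adjacent β a b
    · exact Relation.TransGen.single hadj
    · have hc : ∃ c, (β a < β c ∧ β c < β b) ∨ (β b < β c ∧ β c < β a) := by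
        by_contra! hcon
        exact hadj ⟨hab, fun c => ⟨fun h => (hcon c).1 h.1 h.2, fun h => (hcon c).2 h.1 h.2⟩⟩
      obtain ⟨c, hc⟩ := hc
      have h := (hβ a b).1 hab
      simp only [Prod.lt_iff] at hc
      have h1 : a < c := (hβ a c).2 (by omega)
      have h2 : c < b := (hβ c b).2 (by omega)
      exact (ih (c - a) (by omega) h1 (by omega) rfl).trans
        (ih (b - c) (by omega) h2 (by omega) rfl)

theorem lt_and_lt_of_not_forced (hβ : IsColumnReading β) (hab : a < b) (h : ¬ Forced β a b) :
    (β a).1 < (β b).1 ∧ (β a).2 < (β b).2 := by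
  have h1 : (β a).2 < (β b).2 := lt_of_not_ge fun hge => h (forced_of_snd_le hβ hab hge)
  have := (hβ a b).1 hab
  omega

/-- A forced inequality splits at every box in between: if the intermediate box is comparable to
neither end by a forced inequality, then it lies in the rectangle spanned by some step of the chain
of adjacent boxes. -/
theorem Forced.split (hβ : IsColumnReading β) (h : Forced β a b) (hac : a < c) (hcb : c < b) :
    Forced β a c ∨ Forced β c b := by
  have key : ∀ p q, Adjacent β p q → p < c → c < q → Forced β p c ∨ Forced β c q := by
    intro p q hpq hpc hcq
    by_contra! hcon
    have h1 := lt_and_lt_of_not_forced hβ hpc hcon.1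
    have h2 := lt_and_lt_of_not_forced hβ hcq hcon.2
    exact (hpq.2 c).1 ⟨Prod.lt_iff.2 (Or.inl ⟨h1.1, h1.2.le⟩),
      Prod.lt_iff.2 (Or.inl ⟨h2.1, h2.2.le⟩)⟩
  induction h with
  | single h => exact key _ _ h hac hcb
  | @tail p q hap hpq ih =>
    rcases lt_trichotomy c p with hcp | rfl | hpc
    · exact (ih hcp).imp_right fun h => h.tail hpq
    · exact Or.inl hap
    · exact (key _ _ hpq hpc hcb).imp_left fun h => Relation.TransGen.trans hap h

/-- Transitivity is the splitting property `Forced.split`, in each of the ways in which the three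
pairs can be forced or reversed. -/
theorem precedes_trans (hβ : IsColumnReading β) (hab : Precedes β a b) (hbc : Precedes β b c) :
    Precedes β a c := by
  rcases hab with hab | ⟨hba, hab⟩ <;> rcases hbc with hbc | ⟨hcb, hbc⟩
  · exact Or.inl (Relation.TransGen.trans hab hbc)
  · rcases lt_trichotomy a c with h | rfl | h
    · exact Or.inl ((hab.split hβ h hcb).resolve_right hbc)
    · exact absurd hab hbc
    · exact Or.inr ⟨h, fun h' => hbc (Relation.TransGen.trans h' hab)⟩
  · rcases lt_trichotomy a c with h | rfl | h
    · exact Or.inl ((hbc.split hβ hba h).resolve_left hab)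
    · exact absurd hbc hab
    · exact Or.inr ⟨h, fun h' => hab (Relation.TransGen.trans hbc h')⟩
  · exact Or.inr ⟨hcb.trans hba, fun h => (h.split hβ hcb hba).elim hbc hab⟩

theorem exists_perm_precedes (hβ : IsColumnReading β) :
    ∃ π : Equiv.Perm (Fin N), ∀ a b, π a < π b ↔ Precedes β a b := by
  refine exists_perm_lt_iff _ ?_ (fun a b c => precedes_trans hβ) ?_
  · rintro a (h | h)
    · exact lt_irrefl _ h.lt
    · exact lt_irrefl _ h.1
  · intro a b hne
    by_cases h1 : Forced β a b
    · exact Or.inl (Or.inl h1)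
    · by_cases h2 : Forced β b a
      · exact Or.inr (Or.inl h2)
      · rcases lt_or_gt_of_ne hne with h | h
        · exact Or.inr (Or.inr ⟨h, h1⟩)
        · exact Or.inl (Or.inr ⟨h, h2⟩)

end Boxes

/-! ### The relabeling procedure -/

section Relabeling

variable {D : Finset (ℕ × ℕ)} {N : ℕ} {Z : Filling D N} {π τ : Equiv.Perm (Fin N)} {k : ℕ}

theorem Filling.pos_trans_apply (Z : Filling D N) (τ : Equiv.Perm (Fin N)) (a : Fin N) :
    Filling.pos (Z.trans τ) (τ a) = Z.pos a := by
  simp [Filling.pos]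

/-- The labeling `τ` agrees with `π` on the first `k` entries of `π`, and keeps the remaining
entries in their original order. -/
structure IsPartialSort (π τ : Equiv.Perm (Fin N)) (k : ℕ) : Prop where
  eq_of_lt : ∀ a, (π a : ℕ) < k → τ a = π a
  mono : ∀ a b, k ≤ (π a : ℕ) → k ≤ (π b : ℕ) → a < b → τ a < τ b

namespace IsPartialSort

theorem le_iff (h : IsPartialSort π τ k) (a : Fin N) : k ≤ (τ a : ℕ) ↔ k ≤ (π a : ℕ) := by
  constructor
  · intro h1
    by_contra! hlt
    rw [h.eq_of_lt a hlt] at h1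
    omega
  · intro h1
    by_contra! hlt
    have h2 := h.eq_of_lt (π⁻¹ (τ a)) (by rwa [perm_apply_inv])
    rw [perm_apply_inv, τ.apply_eq_iff_eq] at h2
    rw [← h2, perm_apply_inv] at h1
    omega

theorem lt_iff (h : IsPartialSort π τ k) {a b : Fin N} (ha : k ≤ (π a : ℕ))
    (hb : k ≤ (π b : ℕ)) : τ a < τ b ↔ a < b := by
  refine ⟨fun hlt => lt_of_not_ge fun hge => ?_, h.mono a b ha hb⟩
  rcases hge.lt_or_eq with h' | rfl
  · exact lt_asymm hlt (h.mono b a hb ha h')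
  · exact lt_irrefl _ hlt

/-- Moving the entry that `π` puts in place `k` to this place is one more step of the sorting. -/
theorem step (h : IsPartialSort π τ k) (hk : k < N) :
    IsPartialSort π (τ.trans (Fin.cycleIcc ⟨k, hk⟩ (τ (π⁻¹ ⟨k, hk⟩)))) (k + 1) := by
  have : NeZero N := ⟨by omega⟩
  set i : Fin N := ⟨k, hk⟩
  set x := τ (π⁻¹ i) with hx
  have hix : i ≤ x := Fin.le_def.2 ((h.le_iff _).2 (by rw [perm_apply_inv]))
  have hval : ∀ y, i ≤ y → y ≠ x →
      (Fin.cycleIcc i x y : ℕ) = if y < x then (y : ℕ) + 1 else y := by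
    intro y hy hyx
    rcases lt_or_gt_of_ne hyx with hlt | hgt
    · rw [Fin.cycleIcc_of_ge_of_lt hy hlt, if_pos hlt, Fin.val_add_one_of_lt']
      have := x.2
      omega
    · rw [Fin.cycleIcc_of_gt hgt, if_neg hgt.not_gt]
  constructor
  · intro a ha
    rcases Nat.lt_succ_iff_lt_or_eq.1 ha with ha | ha
    · rw [Equiv.trans_apply, h.eq_of_lt a ha, Fin.cycleIcc_of_lt (Fin.lt_def.2 ha)]
    · have ha' : π a = i := Fin.ext ha
      have : a = π⁻¹ i := by rw [← ha', perm_inv_apply]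
      rw [Equiv.trans_apply, ha', this, ← hx, Fin.cycleIcc_of_last hix]
  · intro a b ha hb hab
    have hne : ∀ c, k + 1 ≤ (π c : ℕ) → τ c ≠ x := fun c hc he => by
      rw [hx, τ.apply_eq_iff_eq] at he
      rw [he, perm_apply_inv] at hc
      exact absurd hc (Nat.not_succ_le_self k)
    have hlt := h.mono a b (by omega) (by omega) hab
    rw [Fin.lt_def, Equiv.trans_apply, Equiv.trans_apply,
      hval _ (Fin.le_def.2 ((h.le_iff a).2 (by omega))) (hne a ha),
      hval _ (Fin.le_def.2 ((h.le_iff b).2 (by omega))) (hne b hb)]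
    have hne' := Fin.val_ne_of_ne (hne b hb)
    rw [Fin.lt_def] at hlt
    split_ifs with h1 h2 h2 <;> rw [Fin.lt_def] at h1 h2 <;> omega

/-- Among the remaining entries, the one that comes first for `Precedes` is admissible unless it is
also the first one in column reading order. -/
theorem admissible_of_ne (h : IsPartialSort π τ k) (hβ : IsColumnReading Z.pos)
    (hπ : ∀ a b, π a < π b ↔ Precedes Z.pos a b) (hk : k < N)
    (hne : τ (π⁻¹ ⟨k, hk⟩) ≠ ⟨k, hk⟩) :
    Admissible (Z.trans τ) ⟨k, hk⟩ (τ (π⁻¹ ⟨k, hk⟩)) := by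
  set i : Fin N := ⟨k, hk⟩ with hi
  set m := π⁻¹ i with hm
  have hπm : π m = i := perm_apply_inv _ _
  have hkm : k ≤ (π m : ℕ) := by rw [hπm]
  have key : ∀ a, k ≤ (π a : ℕ) → a < m → ¬ Forced Z.pos a m := by
    intro a ha ham hf
    have h1 : π a < π m := (hπ a m).2 (Or.inl hf)
    rw [hπm, Fin.lt_def] at h1
    exact absurd ha (not_le.2 h1)
  have hlt : i < τ m := lt_of_le_of_ne (Fin.le_def.2 ((h.le_iff _).2 hkm)) hne.symm
  have key2 : ∀ j, i ≤ j → j < τ m → ∃ a, j = τ a ∧ a < m ∧ ¬ Forced Z.pos a m := by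
    intro j hij hjm
    refine ⟨τ⁻¹ j, (perm_apply_inv _ _).symm, ?_⟩
    have h1 : k ≤ (π (τ⁻¹ j) : ℕ) := (h.le_iff _).1 (by rw [perm_apply_inv]; exact hij)
    have h2 : τ⁻¹ j < m := (h.lt_iff h1 hkm).1 (by rwa [perm_apply_inv])
    exact ⟨h2, key _ h1 h2⟩
  refine ⟨hlt, ?_, ?_, ?_⟩
  · obtain ⟨a, ha, h1, h2⟩ := key2 i le_rfl hlt
    rw [ha, Filling.pos_trans_apply, Filling.pos_trans_apply]
    exact (lt_and_lt_of_not_forced hβ h1 h2).1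
  · obtain ⟨a, ha, h1, h2⟩ := key2 i le_rfl hlt
    rw [ha, Filling.pos_trans_apply, Filling.pos_trans_apply]
    exact (lt_and_lt_of_not_forced hβ h1 h2).2
  · intro j hij hjm
    obtain ⟨a, rfl, h1, h2⟩ := key2 j hij hjm
    rw [Filling.pos_trans_apply, Filling.pos_trans_apply]
    have h3 := lt_and_lt_of_not_forced hβ h1 h2
    refine ⟨h3.2, h3.1.le, fun hcov => h2 (Relation.TransGen.single ⟨h1, fun c => ⟨?_, ?_⟩⟩)⟩
    · rintro ⟨h4, h5⟩
      refine @hcov.2 (τ c) ?_ ?_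
      · change Filling.pos (Z.trans τ) _ < Filling.pos (Z.trans τ) _
        rwa [Filling.pos_trans_apply, Filling.pos_trans_apply]
      · change Filling.pos (Z.trans τ) _ < Filling.pos (Z.trans τ) _
        rwa [Filling.pos_trans_apply, Filling.pos_trans_apply]
    · rintro ⟨h4, h5⟩
      have := (h4.trans h5).le.1
      omega

/-- An admissible entry comes, for `Precedes`, before all remaining entries that are smaller in
column reading order: a forced inequality would end in a covered box. -/
theorem lt_of_admissible (h : IsPartialSort π τ k)
    (hπ : ∀ a b, π a < π b ↔ Precedes Z.pos a b) (hk : k < N) {a a' : Fin N}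
    (ha : Admissible (Z.trans τ) ⟨k, hk⟩ (τ a)) (hka' : k ≤ (π a' : ℕ)) (haa' : a' < a) :
    π a < π a' := by
  have hka : k ≤ (π a : ℕ) := (h.le_iff a).1 (Fin.le_def.1 ha.1.le)
  refine (hπ a a').2 (Or.inr ⟨haa', fun hf => ?_⟩)
  obtain ⟨p, hp, hpa⟩ := Relation.TransGen.tail'_iff.1 hf
  have hkp : k ≤ (π p : ℕ) := by
    rcases Relation.reflTransGen_iff_eq_or_transGen.1 hp with rfl | hp
    · exact hka'
    · have h1 : π a' < π p := (hπ _ _).2 (Or.inl hp)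
      exact hka'.trans (Fin.lt_def.1 h1).le
  obtain ⟨h1, h2, h3⟩ := ha.2.2.2 (τ p) (Fin.le_def.2 ((h.le_iff p).2 hkp))
    ((h.lt_iff hkp hka).2 hpa.1)
  refine h3 ⟨?_, fun c hc hc' => ?_⟩
  · change Filling.pos (Z.trans τ) _ < Filling.pos (Z.trans τ) _
    exact Prod.lt_iff.2 (Or.inr ⟨h2, h1⟩)
  · change Filling.pos (Z.trans τ) _ < Filling.pos (Z.trans τ) _ at hc hc'
    obtain ⟨q, rfl⟩ := τ.surjective c
    rw [Filling.pos_trans_apply, Filling.pos_trans_apply] at hc hc'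
    exact (hpa.2 q).1 ⟨hc, hc'⟩

/-- One step of the procedure moves the entry that comes first for `Precedes` among the remaining
ones. -/
theorem relabelStep_eq (h : IsPartialSort π τ k) (hβ : IsColumnReading Z.pos)
    (hπ : ∀ a b, π a < π b ↔ Precedes Z.pos a b) (hk : k < N) :
    relabelStep (Z.trans τ) ⟨k, hk⟩ =
      Z.trans (τ.trans (Fin.cycleIcc ⟨k, hk⟩ (τ (π⁻¹ ⟨k, hk⟩)))) := by
  have : NeZero N := ⟨by omega⟩
  unfold relabelStep
  split_ifs with hne
  -- The uppermost admissible entry is `τ m`, where `m` comes first among the remaining entries.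
  · obtain ⟨hx, hmax⟩ := (exists_uppermost (Z.trans τ) ⟨k, hk⟩ hne).choose_spec
    set x := (exists_uppermost (Z.trans τ) ⟨k, hk⟩ hne).choose
    suffices x = τ (π⁻¹ ⟨k, hk⟩) by rw [← this, Equiv.trans_assoc]
    set m := π⁻¹ ⟨k, hk⟩ with hm
    have hπm : π m = ⟨k, hk⟩ := perm_apply_inv _ _
    have hkm : k ≤ (π m : ℕ) := by rw [hπm]
    obtain ⟨a, ha⟩ := τ.surjective x
    rw [← ha] at hx hmax ⊢
    have hka : k ≤ (π a : ℕ) := (h.le_iff a).1 (Fin.le_def.1 hx.1.le)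
    rcases lt_trichotomy a m with hlt | heq | hgt
    -- An admissible entry other than `τ m` lies strictly below `τ m`, which is admissible.
    · exfalso
      have hnf : ¬ Forced Z.pos a m := fun hf => by
        have h1 := Fin.lt_def.1 ((hπ a m).2 (Or.inl hf))
        rw [hπm] at h1
        exact absurd hka (not_le.2 h1)
      have hadm := h.admissible_of_ne hβ hπ hk
        (hx.1.trans ((h.lt_iff hka hkm).2 hlt)).ne'
      have h2 := hmax _ hadm
      rw [Filling.pos_trans_apply, Filling.pos_trans_apply] at h2
      exact h2.not_gt (lt_and_lt_of_not_forced hβ hlt hnf).2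
    · rw [heq]
    · have h1 := Fin.lt_def.1 (h.lt_of_admissible hπ hk hx hkm hgt)
      rw [hπm] at h1
      exact absurd hka (not_le.2 h1)
  · have h1 : τ (π⁻¹ ⟨k, hk⟩) = ⟨k, hk⟩ := by
      by_contra hne'
      exact hne ⟨_, h.admissible_of_ne hβ hπ hk hne'⟩
    rw [h1, Fin.cycleIcc_eq]
    rfl

end IsPartialSort

/-- Started from the column reading, the relabeling procedure sorts the boxes by `Precedes`. -/
theorem foldl_relabelStep_eq (hβ : IsColumnReading Z.pos)
    (hπ : ∀ a b, π a < π b ↔ Precedes Z.pos a b) :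
    (List.finRange N).foldl relabelStep Z = Z.trans π := by
  have key : ∀ k ≤ N, ∃ τ : Equiv.Perm (Fin N), IsPartialSort π τ k ∧
      ((List.finRange N).take k).foldl relabelStep Z = Z.trans τ := by
    intro k
    induction k with
    | zero =>
      exact fun _ => ⟨Equiv.refl _, ⟨fun a h => absurd h (Nat.not_lt_zero _),
        fun a b _ _ h => h⟩, by rw [List.take_zero, List.foldl_nil, Equiv.trans_refl]⟩
    | succ k ih =>
      intro hk
      obtain ⟨τ, hτ, hf⟩ := ih (by omega)
      refine ⟨_, hτ.step hk, ?_⟩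
      rw [List.take_succ_eq_append_getElem (by simpa using hk), List.foldl_append, hf,
        List.foldl_cons, List.foldl_nil, List.getElem_finRange]
      exact hτ.relabelStep_eq hβ hπ hk
  obtain ⟨τ, hτ, hf⟩ := key N le_rfl
  rw [List.take_of_length_le (by simp)] at hf
  rw [hf]
  congr 1
  ext a
  rw [hτ.eq_of_lt a (π a).2]

end Relabeling

/-! ### Blocks, longest elements of parabolic subgroups and longest coset representatives -/

section Blocks

variable {n : ℕ} {A S : Set (Fin n)} {a b : Fin (n + 1)} {i : Fin n}

theorem blockIndex_mono (A : Set (Fin n)) : Monotone (blockIndex A) := by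
  intro a b hab
  refine Nat.add_le_add_right (Finset.card_le_card ?_) 1
  intro i hi
  simp only [Finset.mem_filter, Finset.mem_univ, true_and] at hi ⊢
  exact ⟨hi.1, hi.2.trans_le hab⟩

theorem blockIndex_succ_of_mem (h : i ∈ A) :
    blockIndex A i.succ = blockIndex A i.castSucc + 1 := by
  classical
  unfold blockIndex
  rw [add_left_inj, ← Finset.card_insert_of_notMem (a := i) (by simp)]
  congr 1
  ext j
  simp only [Finset.mem_filter, Finset.mem_univ, true_and, Finset.mem_insert,
    Fin.castSucc_lt_succ_iff, Fin.castSucc_lt_castSucc_iff]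
  constructor
  · rintro ⟨h1, h2⟩
    exact h2.eq_or_lt.imp_right fun h2 => ⟨h1, h2⟩
  · rintro (rfl | ⟨h1, h2⟩)
    · exact ⟨h, le_rfl⟩
    · exact ⟨h1, h2.le⟩

theorem blockIndex_succ_of_notMem (h : i ∉ A) :
    blockIndex A i.succ = blockIndex A i.castSucc := by
  unfold blockIndex
  congr 2
  ext j
  simp only [Finset.mem_filter, Finset.mem_univ, true_and,
    Fin.castSucc_lt_succ_iff, Fin.castSucc_lt_castSucc_iff]
  refine and_congr_right fun hj => ⟨fun h2 => lt_of_le_of_ne h2 ?_, le_of_lt⟩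
  rintro rfl
  exact h hj

theorem blockIndex_zero (A : Set (Fin n)) : blockIndex A 0 = 1 := by
  simp [blockIndex]

theorem image_blockIndex (A : Set (Fin n)) :
    Finset.univ.image (blockIndex A) = Finset.Icc 1 (blockIndex A (Fin.last n)) := by
  have key : ∀ r v, 1 ≤ v → v ≤ blockIndex A r → ∃ r', blockIndex A r' = v := by
    intro r
    induction r using Fin.induction with
    | zero =>
      intro v h1 h2
      rw [blockIndex_zero] at h2
      exact ⟨0, by rw [blockIndex_zero]; omega⟩
    | succ i ih =>
      intro v h1 h2
      rcases h2.eq_or_lt with rfl | h2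
      · exact ⟨_, rfl⟩
      · refine ih v h1 ?_
        by_cases hi : i ∈ A
        · rw [blockIndex_succ_of_mem hi] at h2
          omega
        · rw [blockIndex_succ_of_notMem hi] at h2
          omega
  ext v
  simp only [Finset.mem_image, Finset.mem_univ, true_and, Finset.mem_Icc]
  constructor
  · rintro ⟨r, rfl⟩
    exact ⟨Nat.le_add_left 1 _, blockIndex_mono A (Fin.le_last r)⟩
  · rintro ⟨h1, h2⟩
    exact key _ v h1 h2

/-- A transitive relation that holds between neighbours within the blocks holds within the
blocks. -/
theorem rel_of_blockIndex_eq (r : Fin (n + 1) → Fin (n + 1) → Prop)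
    (htrans : ∀ a b c, r a b → r b c → r a c) (hr : ∀ i ∉ A, r i.castSucc i.succ)
    (hab : a < b) (h : blockIndex A a = blockIndex A b) : r a b := by
  induction b using Fin.induction with
  | zero => exact absurd hab (Fin.not_lt_zero a)
  | succ j ih =>
    have haj : a ≤ j.castSucc := Fin.le_castSucc_iff.2 hab
    have hj : j ∉ A := fun hj => by
      have h1 := blockIndex_mono A haj
      rw [blockIndex_succ_of_mem hj] at h
      omega
    rcases haj.eq_or_lt with rfl | haj
    · exact hr j hj
    · exact htrans _ _ _ (ih haj (by rw [h, blockIndex_succ_of_notMem hj])) (hr j hj)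

theorem longest_mem {A : Set (Equiv.Perm (Fin (n + 1)))} (hA : A.Nonempty) : longest A hA ∈ A :=
  (exists_longest hA).choose_spec.1

theorem len_le_longest {A : Set (Equiv.Perm (Fin (n + 1)))} (hA : A.Nonempty) :
    ∀ u ∈ A, len u ≤ len (longest A hA) :=
  (exists_longest hA).choose_spec.2

theorem w0_mem (S : Set (Fin n)) : w0 S ∈ parabolic S :=
  longest_mem ⟨1, one_mem (parabolic S)⟩

theorem blockIndex_apply_of_mem_parabolic {u : Equiv.Perm (Fin (n + 1))} (hu : u ∈ parabolic S)
    (a : Fin (n + 1)) : blockIndex Sᶜ (u a) = blockIndex Sᶜ a := by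
  induction hu using Subgroup.closure_induction generalizing a with
  | mem x hx =>
    obtain ⟨i, hi, rfl⟩ := hx
    have h1 : blockIndex Sᶜ i.succ = blockIndex Sᶜ i.castSucc :=
      blockIndex_succ_of_notMem fun h => h hi
    rw [simpleTransp, Equiv.swap_apply_def]
    split_ifs with h2 h3
    · rw [h2, h1]
    · rw [h3, h1]
    · rfl
  | one => rfl
  | mul x y _ _ hx hy => rw [Equiv.Perm.mul_apply, hx, hy]
  | inv x _ hx => rw [← hx, perm_apply_inv]

/-- The elements `s_i` with `i ∈ S` are right descents of `w₀(S)`, as it has maximal length. -/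
theorem w0_succ_lt (hi : i ∈ S) : w0 S i.succ < w0 S i.castSucc := by
  have hle : len (w0 S * simpleTransp i) ≤ len (w0 S) :=
    len_le_longest _ _ (mul_mem (w0_mem S) (Subgroup.subset_closure ⟨i, hi, rfl⟩))
  by_contra hcon
  have h1 : i ∈ desR (w0 S * simpleTransp i) := by
    rw [mem_desR, Equiv.Perm.mul_apply, Equiv.Perm.mul_apply, simpleTransp,
      Equiv.swap_apply_left, Equiv.swap_apply_right]
    exact lt_of_le_of_ne (not_lt.1 hcon) ((w0 S).injective.ne (Fin.castSucc_lt_succ).ne)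
  have h2 : len (w0 S * simpleTransp i * simpleTransp i) < len (w0 S * simpleTransp i) := h1
  rw [mul_assoc, simpleTransp_mul_self, mul_one] at h2
  omega

/-- `w₀(S)` reverses every block. -/
theorem w0_lt_iff (hab : a < b) : w0 S b < w0 S a ↔ blockIndex Sᶜ a = blockIndex Sᶜ b := by
  constructor
  · intro h
    refine le_antisymm (blockIndex_mono _ hab.le) ?_
    rw [← blockIndex_apply_of_mem_parabolic (w0_mem S) a,
      ← blockIndex_apply_of_mem_parabolic (w0_mem S) b]
    exact blockIndex_mono _ h.le
  · exact rel_of_blockIndex_eq (fun a b => w0 S b < w0 S a) (fun a b c h1 h2 => h2.trans h1)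
      (fun i hi => w0_succ_lt (not_not.1 hi)) hab

theorem w0_univ_apply (a : Fin (n + 1)) : w0 Set.univ a = a.rev := by
  have h : Fin.revPerm * w0 (Set.univ : Set (Fin n)) = 1 := by
    refine eq_one_of_strictMono (Fin.strictMono_iff_lt_succ.2 fun i => ?_)
    rw [Equiv.Perm.mul_apply, Equiv.Perm.mul_apply, Fin.revPerm_apply, Fin.revPerm_apply,
      Fin.rev_lt_rev]
    exact w0_succ_lt (Set.mem_univ i)
  have h1 := Equiv.congr_fun h a
  rw [Equiv.Perm.mul_apply, Fin.revPerm_apply, Equiv.Perm.one_apply] at h1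
  rw [← h1, Fin.rev_rev, h1]

theorem w0_univ_mul_self : w0 Set.univ * w0 (Set.univ : Set (Fin n)) = 1 := by
  ext a
  rw [Equiv.Perm.mul_apply, w0_univ_apply, w0_univ_apply, Fin.rev_rev, Equiv.Perm.one_apply]

/-- Elements of `minReps Sᶜ` are increasing on the blocks cut out by `S`, so all their inversions
are inversions of `w₀ w₀(Sᶜ)`, which lies in this set itself. -/
theorem w1_eq (S : Set (Fin n)) : w1 S = w0 Set.univ * w0 Sᶜ := by
  have hmem : w0 Set.univ * w0 Sᶜ ∈ minReps Sᶜ := by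
    intro i hi
    rw [mem_desR, Equiv.Perm.mul_apply, Equiv.Perm.mul_apply, w0_univ_apply, w0_univ_apply,
      Fin.rev_lt_rev] at hi
    exact fun h => lt_asymm hi (w0_succ_lt h)
  have hw1 : w1 S ∈ minReps Sᶜ := longest_mem _
  have hle := len_le_longest ⟨1, one_mem_minReps Sᶜ⟩ _ hmem
  change _ ≤ len (w1 S) at hle
  rw [len_eq_card_inversions, len_eq_card_inversions] at hle
  refine eq_of_leftWeakLE_of_card_le (leftWeakLE_iff.2 fun a b hab h => ?_) hle
  rw [Equiv.Perm.mul_apply, Equiv.Perm.mul_apply, w0_univ_apply, w0_univ_apply, Fin.rev_lt_rev]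
  refine lt_of_not_ge fun hge => lt_asymm h ?_
  have hlt := lt_of_le_of_ne hge ((w0 Sᶜ).injective.ne hab.ne')
  rw [w0_lt_iff hab, compl_compl] at hlt
  refine rel_of_blockIndex_eq (fun a b => w1 S a < w1 S b) (fun _ _ _ => lt_trans) ?_ hab hlt
  intro i hi
  have h1 : i ∉ desR (w1 S) := fun h => hw1 h hi
  rw [mem_desR] at h1
  exact lt_of_le_of_ne (not_lt.1 h1) ((w1 S).injective.ne (Fin.castSucc_lt_succ).ne)

end Blocks

/-! ### The diagram of a lower descent interval -/

section LowerDiagram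

variable {n : ℕ} {S : Set (Fin n)} {ρ : Equiv.Perm (Fin (n + 1))} {a b : Fin (n + 1)}

/-- The box of `D_{S;ρ}` that corresponds to the position `a`. -/
noncomputable def boxOf (S : Set (Fin n)) (ρ : Equiv.Perm (Fin (n + 1))) (a : Fin (n + 1)) :
    ℕ × ℕ :=
  (blockIndex Sᶜ a, blockIndex (desL ρ) (ρ a))

/-- Within a column, `ρ` is decreasing. -/
theorem apply_lt_of_fst_boxOf_eq (hρ : leftWeakLE (w0 S) ρ) (hab : a < b)
    (h : (boxOf S ρ a).1 = (boxOf S ρ b).1) : ρ b < ρ a :=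
  leftWeakLE_iff.1 hρ a b hab ((w0_lt_iff hab).2 h)

/-- Within a row, `ρ` is increasing: there are no left descents inside a block of values. -/
theorem lt_of_snd_boxOf_eq (hab : ρ a < ρ b) (h : (boxOf S ρ a).2 = (boxOf S ρ b).2) :
    a < b := by
  have := rel_of_blockIndex_eq (A := desL ρ) (fun x y => ρ⁻¹ x < ρ⁻¹ y) (fun _ _ _ => lt_trans)
    (fun i hi => notMem_desL.1 hi) hab h
  simpa only [perm_inv_apply] using this

theorem isColumnReading_boxOf (hρ : leftWeakLE (w0 S) ρ) : IsColumnReading (boxOf S ρ) := by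
  have key : ∀ a b, a < b → (boxOf S ρ a).1 < (boxOf S ρ b).1 ∨
      ((boxOf S ρ a).1 = (boxOf S ρ b).1 ∧ (boxOf S ρ b).2 < (boxOf S ρ a).2) := by
    intro a b hab
    refine (blockIndex_mono Sᶜ hab.le).lt_or_eq.imp_right fun h => ⟨h, ?_⟩
    have h1 := apply_lt_of_fst_boxOf_eq hρ hab h
    refine lt_of_le_of_ne (blockIndex_mono _ h1.le) fun he => ?_
    exact lt_asymm hab (lt_of_snd_boxOf_eq h1 he)
  intro a b
  refine ⟨key a b, fun h => ?_⟩
  rcases lt_trichotomy a b with h' | rfl | h'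
  · exact h'
  · omega
  · have := key b a h'
    omega

theorem IsColumnReading.injective {N : ℕ} {β : Fin N → ℕ × ℕ} (hβ : IsColumnReading β) :
    Function.Injective β := by
  intro a b h
  by_contra hne
  rcases lt_or_gt_of_ne hne with h' | h'
  · rw [hβ, h] at h'
    omega
  · rw [hβ, h] at h'
    omega

/-- The componentwise order of the boxes is the poset of the interval `[w₀(S), ρ]_L`. -/
theorem boxOf_lt_iff (hρ : leftWeakLE (w0 S) ρ) :
    boxOf S ρ a < boxOf S ρ b ↔ w0 S a < w0 S b ∧ ρ a < ρ b := by
  constructor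
  · intro h
    have h1 := h.le.1
    have h2 := h.le.2
    have hne : a ≠ b := fun he => h.ne (congrArg _ he)
    rcases lt_or_gt_of_ne hne with hab | hab
    · have hc := (isColumnReading_boxOf hρ a b).1 hab
      have hc' : (boxOf S ρ a).1 ≠ (boxOf S ρ b).1 := by omega
      constructor
      · refine lt_of_not_ge fun hge => hc' ((w0_lt_iff hab).1 ?_)
        exact lt_of_le_of_ne hge ((w0 S).injective.ne hne.symm)
      · refine lt_of_not_ge fun hge => ?_
        have hlt := lt_of_le_of_ne hge (ρ.injective.ne hne.symm)
        have h3 : (boxOf S ρ b).2 ≤ (boxOf S ρ a).2 := blockIndex_mono _ hge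
        exact lt_asymm hab (lt_of_snd_boxOf_eq hlt (le_antisymm h3 h2))
    · have h3 : (boxOf S ρ b).1 ≤ (boxOf S ρ a).1 := blockIndex_mono _ (le_of_lt hab)
      have h4 := le_antisymm h3 h1
      exact ⟨(w0_lt_iff hab).2 h4, apply_lt_of_fst_boxOf_eq hρ hab h4⟩
  · rintro ⟨h1, h2⟩
    have hne : a ≠ b := fun he => h1.ne (congrArg _ he)
    refine lt_of_le_of_ne (Prod.le_def.2 ⟨?_, blockIndex_mono _ h2.le⟩)
      ((isColumnReading_boxOf hρ).injective.ne hne)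
    rcases lt_or_gt_of_ne hne with hab | hab
    · exact blockIndex_mono _ hab.le
    · exact ((w0_lt_iff hab).1 h1).ge

theorem blockIndex_mem_Icc (A : Set (Fin n)) (a : Fin (n + 1)) :
    blockIndex A a ∈ Finset.Icc 1 (n + 1) := by
  refine Finset.mem_Icc.2 ⟨Nat.le_add_left 1 _, Nat.add_le_add_right ?_ 1⟩
  exact (Finset.card_le_univ _).trans (Fintype.card_fin n).le

theorem lowerDiagram_eq_image (S : Set (Fin n)) (ρ : Equiv.Perm (Fin (n + 1))) :
    lowerDiagram S ρ = Finset.univ.image (boxOf S ρ) := by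
  ext ⟨x, y⟩
  simp only [lowerDiagram, Finset.mem_filter, Finset.mem_product, Finset.mem_image,
    Finset.mem_univ, true_and, boxOf, Prod.mk.injEq]
  constructor
  · rintro ⟨-, c, ⟨r, h1, rfl⟩, h2⟩
    exact ⟨r, h1, h2⟩
  · rintro ⟨r, rfl, rfl⟩
    exact ⟨⟨blockIndex_mem_Icc _ _, blockIndex_mem_Icc _ _⟩, ρ r, ⟨r, rfl, rfl⟩, rfl⟩

theorem isDiagram_lowerDiagram (hρ : leftWeakLE (w0 S) ρ) :
    IsDiagram (n + 1) (lowerDiagram S ρ) := by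
  have hc : (lowerDiagram S ρ).image Prod.fst =
      Finset.Icc 1 (blockIndex Sᶜ (Fin.last n)) := by
    rw [lowerDiagram_eq_image, Finset.image_image]
    exact image_blockIndex _
  have hr : (lowerDiagram S ρ).image Prod.snd =
      Finset.Icc 1 (blockIndex (desL ρ) (Fin.last n)) := by
    rw [lowerDiagram_eq_image, Finset.image_image, ← image_blockIndex]
    ext y
    simp only [Finset.mem_image, Finset.mem_univ, true_and, Function.comp_apply, boxOf]
    exact (ρ.surjective.exists (p := fun x => blockIndex (desL ρ) x = y)).symm
  refine ⟨?_, ?_, ?_⟩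
  · rw [lowerDiagram_eq_image, Finset.card_image_of_injective _
      (isColumnReading_boxOf hρ).injective, Finset.card_univ, Fintype.card_fin]
  · rw [numCols, hc, Nat.card_Icc, Nat.add_sub_cancel]
  · rw [numRows, hr, Nat.card_Icc, Nat.add_sub_cancel]

theorem fillDown_lt_iff {D : Finset (ℕ × ℕ)} {N : ℕ} (hD : D.card = N)
    (p q : {p : ℕ × ℕ // p ∈ D}) :
    fillDown D hD p < fillDown D hD q ↔ columnReading p < columnReading q :=
  ((D.map columnReading).orderIsoOfFin ((Finset.card_map _).trans hD)).symm.lt_iff_lt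

/-- The filling down the columns puts the entry `a` into the `a`-th box of the column reading. -/
theorem pos_fillDown {D : Finset (ℕ × ℕ)} {N : ℕ} (hD : D.card = N) {β : Fin N → ℕ × ℕ}
    (hβ : IsColumnReading β) (hDβ : D = Finset.univ.image β) : (fillDown D hD).pos = β := by
  have hmem : ∀ a, β a ∈ D := fun a => by
    rw [hDβ]
    exact Finset.mem_image_of_mem _ (Finset.mem_univ a)
  have hmono : StrictMono fun a => fillDown D hD ⟨β a, hmem a⟩ := by
    intro a b hab
    rw [fillDown_lt_iff]
    exact Prod.Lex.toLex_lt_toLex.2 ((hβ a b).1 hab)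
  have hid := (hmono.range_inj strictMono_id).1 (by
    rw [(Finite.injective_iff_surjective.1 hmono.injective).range_eq, Set.range_id])
  funext a
  have h1 := congrFun hid a
  simp only [id_eq] at h1
  rw [Filling.pos, ← h1, Equiv.symm_apply_apply, h1]

end LowerDiagram

/-! ### Positions that become adjacent in a linear extension -/

section AdjacentPositions

variable {n : ℕ}

/-- If no position lies strictly between `a` and `b` in the poset of an interval, and `b` is not
below `a`, then `b` immediately follows `a` in some member of the interval. -/
theorem WeakInterval.exists_mem_carrier_succ (I : WeakInterval n) {a b : Fin (n + 1)} (hne : a ≠ b)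
    (hba : ¬ (I.bot b < I.bot a ∧ I.top b < I.top a))
    (hcov : ∀ c, ¬ ((I.bot a < I.bot c ∧ I.top a < I.top c) ∧
      (I.bot c < I.bot b ∧ I.top c < I.top b))) :
    ∃ γ ∈ I.carrier, (γ b : ℕ) = γ a + 1 := by
  classical
  let P : Fin (n + 1) → Fin (n + 1) → Prop := fun x y => I.bot x < I.bot y ∧ I.top x < I.top y
  have hPtrans : ∀ x y z, P x y → P y z → P x z :=
    fun x y z h h' => ⟨h.1.trans h'.1, h.2.trans h'.2⟩
  have hPirr : ∀ x, ¬ P x x := fun x h => lt_irrefl _ h.1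
  -- First the positions below `a` or `b`, then `a` and `b`, then all others, each part being
  -- ordered as in the least element of the interval.
  let g : Fin (n + 1) → ℕ := fun x =>
    if x = a then 1 else if x = b then 2 else if P x a ∨ P x b then 0 else 3
  have ga : g a = 1 := if_pos rfl
  have gb : g b = 2 := by
    change (if b = a then _ else _) = 2
    rw [if_neg hne.symm, if_pos rfl]
  have g1 : ∀ x, g x = 1 → x = a := by
    intro x hx
    by_contra hxa
    change (if x = a then _ else _) = 1 at hx
    rw [if_neg hxa] at hx
    split_ifs at hx <;> omega
  have g2 : ∀ x, g x = 2 → x = b := by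
    intro x hx
    by_contra hxb
    change (if x = a then _ else if x = b then _ else _) = 2 at hx
    rw [if_neg hxb] at hx
    split_ifs at hx <;> omega
  have g0 : ∀ x, x ≠ a → (P x a ∨ P x b) → g x = 0 := by
    intro x hxa hx
    have hxb : x ≠ b := by
      rintro rfl
      exact hx.elim hba (hPirr _)
    change (if x = a then _ else _) = 0
    rw [if_neg hxa, if_neg hxb, if_pos hx]
  have g0' : ∀ x, g x = 0 → P x a ∨ P x b := by
    intro x hx
    by_contra hcon
    change (if x = a then _ else _) = 0 at hx
    rw [if_neg hcon] at hx
    split_ifs at hx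
  have g3 : ∀ x, g x ≤ 3 := by
    intro x
    change (if x = a then _ else _) ≤ 3
    split_ifs <;> omega
  have gmono : ∀ x y, P x y → g x ≤ g y := by
    intro x y hxy
    by_cases hxa : x = a
    · subst hxa
      rw [ga]
      by_contra hcon
      rcases g0' y (by omega) with h | h
      · exact hPirr _ (hPtrans _ _ _ hxy h)
      · exact hcov y ⟨hxy, h⟩
    · rcases (by have := g3 y; omega : g y = 0 ∨ g y = 1 ∨ g y = 2 ∨ g y = 3) with h | h | h | h
      · rw [g0 x hxa ((g0' y h).imp (hPtrans _ _ _ hxy) (hPtrans _ _ _ hxy))]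
        exact Nat.zero_le _
      · rw [g1 y h] at hxy
        rw [g0 x hxa (Or.inl hxy)]
        exact Nat.zero_le _
      · rw [g2 y h] at hxy
        rw [g0 x hxa (Or.inr hxy)]
        exact Nat.zero_le _
      · rw [h]
        exact g3 x
  obtain ⟨γ, hγ⟩ := exists_perm_lt_iff
    (fun x y => g x < g y ∨ (g x = g y ∧ I.bot x < I.bot y))
    (fun x h => h.elim (lt_irrefl _) fun h => lt_irrefl _ h.2)
    (fun x y z h h' => by
      rcases h with h | ⟨h, h1⟩ <;> rcases h' with h' | ⟨h', h2⟩
      · exact Or.inl (h.trans h')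
      · exact Or.inl (h.trans_eq h')
      · exact Or.inl (h.trans_lt h')
      · exact Or.inr ⟨h.trans h', h1.trans h2⟩)
    (fun x y hxy => by
      rcases lt_trichotomy (g x) (g y) with h | h | h
      · exact Or.inl (Or.inl h)
      · exact (lt_or_gt_of_ne (I.bot.injective.ne hxy)).imp (fun h1 => Or.inr ⟨h, h1⟩)
          fun h1 => Or.inr ⟨h.symm, h1⟩
      · exact Or.inr (Or.inl h))
  refine ⟨γ, (I.mem_carrier_iff γ).2 fun x y h1 h2 => (hγ x y).2 ?_, ?_⟩
  · exact (gmono x y ⟨h1, h2⟩).lt_or_eq.imp_right fun h => ⟨h, h1⟩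
  · have hab : γ a < γ b := (hγ a b).2 (Or.inl (by omega))
    by_contra hsucc
    rw [Fin.lt_def] at hab
    have hlt : (γ a : ℕ) + 1 < n + 1 := by
      have := (γ b).2
      omega
    obtain ⟨c, hc⟩ := γ.surjective ⟨γ a + 1, hlt⟩
    have hc' : (γ c : ℕ) = γ a + 1 := by rw [hc]
    have h1 := (hγ a c).1 (Fin.lt_def.2 (by omega))
    have h2 := (hγ c b).1 (Fin.lt_def.2 (by omega))
    rw [ga] at h1
    rw [gb] at h2
    rcases (by omega : g c = 1 ∨ g c = 2) with h | h
    · rw [g1 c h] at hc'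
      omega
    · rw [g2 c h] at hc'
      omega

end AdjacentPositions

/-! ### The class of a lower descent interval -/

section LowerInterval

variable {n : ℕ} {S : Set (Fin n)} {ρ : Equiv.Perm (Fin (n + 1))}

/-- Every interval in the class of `[w₀(S), ρ]_L` satisfies the forced inequalities. -/
theorem lt_of_forced {hρ : leftWeakLE (w0 S) ρ} {π : Equiv.Perm (Fin (n + 1))}
    {J : WeakInterval n} (h : WeakInterval.IsRelabeling π ⟨w0 S, ρ, hρ⟩ J) {a b : Fin (n + 1)}
    (hab : Forced (boxOf S ρ) a b) : π a < π b := by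
  have key : ∀ a b, Adjacent (boxOf S ρ) a b → π a < π b := by
    rintro a b ⟨hab, hc⟩
    simp only [boxOf_lt_iff hρ] at hc
    by_cases hlt : w0 S b < w0 S a ∧ ρ b < ρ a
    · obtain ⟨γ, hγ, hs⟩ := WeakInterval.exists_mem_carrier_succ ⟨w0 S, ρ, hρ⟩ hab.ne'
        (fun h => lt_asymm h.1 hlt.1) fun c => (hc c).2
      refine (lt_or_gt_of_ne (π.injective.ne hab.ne)).resolve_right fun hgt => ?_
      exact lt_asymm hab ((h.lt_iff_of_succ hγ hs).1 hgt)
    · obtain ⟨γ, hγ, hs⟩ := WeakInterval.exists_mem_carrier_succ ⟨w0 S, ρ, hρ⟩ hab.ne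
        hlt fun c => (hc c).1
      exact (h.lt_iff_of_succ hγ hs).2 hab
  induction hab with
  | single h => exact key _ _ h
  | tail _ h ih => exact ih.trans (key _ _ h)

/-- `[w₀(S), ρ]_L` is the least element of its class: the only pairs of comparable boxes that its
filling `F^↓` inverts lie in one column, and their order is forced. -/
theorem isLeast_eqClass_lower (hρ : leftWeakLE (w0 S) ρ) :
    IsLeast (WeakInterval.eqClass ⟨w0 S, ρ, hρ⟩) ⟨w0 S, ρ, hρ⟩ := by
  refine ⟨WeakInterval.self_mem_eqClass _, fun J hJ => ?_⟩
  obtain ⟨π, hπ⟩ := WeakInterval.mem_eqClass_iff.1 hJ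
  rw [(WeakInterval.isRelabeling_one _).le_iff hπ]
  intro a b h1 h2 hba
  exact lt_of_forced hπ (forced_of_snd_le (isColumnReading_boxOf hρ) hba
    ((boxOf_lt_iff hρ).2 ⟨h1, h2⟩).le.2)

/-- The relabeling of `[w₀(S), ρ]_L` by the order `Precedes` of its boxes is an interval. -/
theorem leftWeakLE_mul_inv_of_precedes (hρ : leftWeakLE (w0 S) ρ)
    {π : Equiv.Perm (Fin (n + 1))} (hπ : ∀ a b, π a < π b ↔ Precedes (boxOf S ρ) a b) :
    leftWeakLE (w0 S * π⁻¹) (ρ * π⁻¹) := by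
  refine leftWeakLE_iff.2 fun x y hxy h => ?_
  obtain ⟨a, rfl⟩ := π.surjective x
  obtain ⟨b, rfl⟩ := π.surjective y
  simp only [Equiv.Perm.mul_apply, perm_inv_apply] at h ⊢
  have hne : a ≠ b := fun he => hxy.ne (congrArg _ he)
  rcases lt_or_gt_of_ne hne with hab | hab
  · exact leftWeakLE_iff.1 hρ a b hab h
  · refine lt_of_not_ge fun hge => lt_asymm hxy ((hπ b a).2 (Or.inl ?_))
    by_contra hf
    have h1 := lt_and_lt_of_not_forced (isColumnReading_boxOf hρ) hab hf
    exact hge.not_gt ((boxOf_lt_iff hρ).1 (Prod.lt_iff.2 (Or.inl ⟨h1.1, h1.2.le⟩))).2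

/-- Positions that are adjacent in a member of the interval have adjacent boxes, whose order is
forced. -/
theorem isRelabeling_of_precedes (hρ : leftWeakLE (w0 S) ρ)
    {π : Equiv.Perm (Fin (n + 1))} (hπ : ∀ a b, π a < π b ↔ Precedes (boxOf S ρ) a b) :
    WeakInterval.IsRelabeling π ⟨w0 S, ρ, hρ⟩
      ⟨w0 S * π⁻¹, ρ * π⁻¹, leftWeakLE_mul_inv_of_precedes hρ hπ⟩ := by
  refine WeakInterval.isRelabeling_of_lt_iff rfl rfl fun γ hγ a b hs => ?_
  rw [WeakInterval.mem_carrier_iff] at hγ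
  have hlt : ∀ x y, boxOf S ρ x < boxOf S ρ y → γ x < γ y := fun x y h =>
    hγ x y ((boxOf_lt_iff hρ).1 h).1 ((boxOf_lt_iff hρ).1 h).2
  have h1 : ∀ c, ¬ (boxOf S ρ a < boxOf S ρ c ∧ boxOf S ρ c < boxOf S ρ b) := fun c h => by
    have h1 := Fin.lt_def.1 (hlt _ _ h.1)
    have h2 := Fin.lt_def.1 (hlt _ _ h.2)
    omega
  have h2 : ∀ c, ¬ (boxOf S ρ b < boxOf S ρ c ∧ boxOf S ρ c < boxOf S ρ a) := fun c h => by
    have h1 := Fin.lt_def.1 (hlt _ _ h.1)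
    have h2 := Fin.lt_def.1 (hlt _ _ h.2)
    omega
  have hne : a ≠ b := by
    rintro rfl
    omega
  rcases lt_or_gt_of_ne hne with hab | hab
  · refine iff_of_true ((hπ a b).2 (Or.inl (Relation.TransGen.single ?_))) hab
    exact ⟨hab, fun c => ⟨h1 c, h2 c⟩⟩
  · refine iff_of_false (lt_asymm ((hπ b a).2 (Or.inl (Relation.TransGen.single ?_)))) hab.not_gt
    exact ⟨hab, fun c => ⟨h2 c, h1 c⟩⟩

/-- The filling `F^↗` sorts the boxes by `Precedes`, which keeps the forced inequalities and reverses
all others; hence no member of the class is larger. -/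
theorem exists_isGreatest_eqClass_lower (hρ : leftWeakLE (w0 S) ρ)
    (hD : IsDiagram (n + 1) (lowerDiagram S ρ)) :
    ∃ M : WeakInterval n,
      M.carrier = linExt (fillNE (lowerDiagram S ρ) hD.card_eq).poset ∧
      IsGreatest (WeakInterval.eqClass ⟨w0 S, ρ, hρ⟩) M := by
  have hβ := isColumnReading_boxOf hρ
  have hpos := pos_fillDown hD.card_eq hβ (lowerDiagram_eq_image S ρ)
  obtain ⟨π, hπ⟩ := exists_perm_precedes hβ
  have hfill : fillNE (lowerDiagram S ρ) hD.card_eq =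
      (fillDown (lowerDiagram S ρ) hD.card_eq).trans π :=
    foldl_relabelStep_eq (by rwa [hpos]) (by rwa [hpos])
  have hM := isRelabeling_of_precedes hρ hπ
  refine ⟨_, ?_, WeakInterval.mem_eqClass_iff.2 ⟨π, hM⟩, fun J hJ => ?_⟩
  · ext δ
    rw [WeakInterval.mem_carrier_iff]
    change _ ↔ ∀ i j, (fillNE (lowerDiagram S ρ) hD.card_eq).pos i ≤
      (fillNE (lowerDiagram S ρ) hD.card_eq).pos j → δ i ≤ δ j
    rw [hfill, ← π.forall_congr_right]
    conv_rhs => rw [← π.forall_congr_right]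
    refine forall_congr' fun a => ?_
    rw [← π.forall_congr_right]
    conv_rhs => rw [← π.forall_congr_right]
    refine forall_congr' fun b => ?_
    rw [hM.bot_apply, hM.bot_apply, hM.top_apply, hM.top_apply, Filling.pos_trans_apply,
      Filling.pos_trans_apply, hpos, ← and_imp, ← boxOf_lt_iff hρ]
    constructor
    · intro h hle
      rcases hle.lt_or_eq with hlt | heq
      · exact (h hlt).le
      · rw [hβ.injective heq]
    · intro h hlt
      refine lt_of_le_of_ne (h hlt.le) fun he => ?_
      rw [π.injective (δ.injective he)] at hlt
      exact lt_irrefl _ hlt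
  · obtain ⟨π', hπ'⟩ := WeakInterval.mem_eqClass_iff.1 hJ
    rw [hπ'.le_iff hM]
    intro a b h1 h2 hlt
    refine lt_of_not_ge fun hge => ?_
    have hne : a ≠ b := fun he => h1.ne (congrArg _ he)
    rcases (hπ a b).1 (lt_of_le_of_ne hge (π.injective.ne hne)) with hf | ⟨hba, hf⟩
    · exact lt_asymm hlt (lt_of_forced hπ' hf)
    · have h3 := (lt_and_lt_of_not_forced hβ hba hf).1
      have h4 := ((boxOf_lt_iff hρ).2 ⟨h1, h2⟩).le.1
      omega

end LowerInterval

/-! ### Multiplication by the longest element -/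

section Duality

variable {n : ℕ} {σ τ : Equiv.Perm (Fin (n + 1))}

theorem w0_univ_mul_lt_iff {a b : Fin (n + 1)} :
    (w0 Set.univ * σ : Equiv.Perm (Fin (n + 1))) a < (w0 Set.univ * σ : Equiv.Perm (Fin (n + 1))) b ↔
      σ b < σ a := by
  rw [Equiv.Perm.mul_apply, Equiv.Perm.mul_apply, w0_univ_apply, w0_univ_apply, Fin.rev_lt_rev]

theorem leftWeakLE_w0_univ_mul (h : leftWeakLE σ τ) :
    leftWeakLE (w0 Set.univ * τ) (w0 Set.univ * σ) := by
  rw [leftWeakLE_iff] at h ⊢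
  simp only [w0_univ_mul_lt_iff]
  intro a b hab hlt
  refine lt_of_not_ge fun hge => lt_asymm hlt (h a b hab ?_)
  exact lt_of_le_of_ne hge (σ.injective.ne hab.ne')

namespace WeakInterval

/-- The image of an interval under the anti-automorphism `γ ↦ w₀ γ` of the left weak order. -/
noncomputable def dual (I : WeakInterval n) : WeakInterval n where
  bot := w0 Set.univ * I.top
  top := w0 Set.univ * I.bot
  le := leftWeakLE_w0_univ_mul I.le

theorem dual_dual (I : WeakInterval n) : I.dual.dual = I := by
  ext1
  · change w0 Set.univ * (w0 Set.univ * I.bot) = I.bot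
    rw [← mul_assoc, w0_univ_mul_self, one_mul]
  · change w0 Set.univ * (w0 Set.univ * I.top) = I.top
    rw [← mul_assoc, w0_univ_mul_self, one_mul]

theorem mem_carrier_dual_iff {I : WeakInterval n} :
    σ ∈ I.dual.carrier ↔ w0 Set.univ * σ ∈ I.carrier := by
  rw [mem_carrier_iff, mem_carrier_iff, forall_comm]
  simp only [dual, w0_univ_mul_lt_iff]
  exact forall₂_congr fun a b => ⟨fun h h1 h2 => h h2 h1, fun h h1 h2 => h h2 h1⟩

variable {I J J₁ J₂ : WeakInterval n} {π π₁ π₂ : Equiv.Perm (Fin (n + 1))}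

theorem IsRelabeling.dual (h : IsRelabeling π I J) : IsRelabeling π I.dual J.dual := by
  refine isRelabeling_of_lt_iff ?_ ?_ fun γ hγ a b hs => ?_
  · change w0 Set.univ * J.top = w0 Set.univ * I.top * π⁻¹
    rw [h.top_eq, mul_assoc]
  · change w0 Set.univ * J.bot = w0 Set.univ * I.bot * π⁻¹
    rw [h.bot_eq, mul_assoc]
  · have hne : a ≠ b := by
      rintro rfl
      omega
    have h1 := h.lt_iff_of_succ (mem_carrier_dual_iff.1 hγ) (a := b) (b := a) (by
      rw [Equiv.Perm.mul_apply, Equiv.Perm.mul_apply, w0_univ_apply, w0_univ_apply, Fin.val_rev,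
        Fin.val_rev]
      have := (γ b).2
      omega)
    rw [← not_iff_not, not_lt, not_lt, (π.injective.ne hne).symm.le_iff_lt, hne.symm.le_iff_lt]
    exact h1

theorem dual_mem_eqClass (h : J ∈ I.eqClass) : J.dual ∈ I.dual.eqClass := by
  obtain ⟨π, hπ⟩ := mem_eqClass_iff.1 h
  exact mem_eqClass_iff.2 ⟨π, hπ.dual⟩

/-- On an equivalence class, the dual reverses the order. -/
theorem dual_le_dual (h₁ : J₁ ∈ I.eqClass) (h₂ : J₂ ∈ I.eqClass) (h : J₁ ≤ J₂) :
    J₂.dual ≤ J₁.dual := by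
  obtain ⟨π₁, h₁⟩ := mem_eqClass_iff.1 h₁
  obtain ⟨π₂, h₂⟩ := mem_eqClass_iff.1 h₂
  rw [h₁.le_iff h₂] at h
  rw [h₂.dual.le_iff h₁.dual]
  simp only [WeakInterval.dual, w0_univ_mul_lt_iff]
  intro a b h3 h4 hlt
  refine lt_of_not_ge fun hge => lt_asymm hlt (h b a h4 h3 ?_)
  exact lt_of_le_of_ne hge (π₁.injective.ne fun he => h3.ne' (congrArg _ he))

end WeakInterval

theorem starBox_le_iff {N : ℕ} {D : Finset (ℕ × ℕ)} (hD : IsDiagram N D) {p q : ℕ × ℕ}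
    (hp : p ∈ D) (hq : q ∈ D) : starBox D p ≤ starBox D q ↔ q ≤ p := by
  have h1 : ∀ z ∈ D, z.1 ≤ numCols D := fun z hz => by
    have := Finset.mem_image_of_mem Prod.fst hz
    rw [hD.cols] at this
    exact (Finset.mem_Icc.1 this).2
  have h2 : ∀ z ∈ D, z.2 ≤ numRows D := fun z hz => by
    have := Finset.mem_image_of_mem Prod.snd hz
    rw [hD.rows] at this
    exact (Finset.mem_Icc.1 this).2
  have hp1 := h1 p hp
  have hq1 := h1 q hq
  have hp2 := h2 p hp
  have hq2 := h2 q hq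
  simp only [starBox, Prod.le_def]
  omega

theorem Filling.pos_star {N : ℕ} {D : Finset (ℕ × ℕ)} (hD : IsDiagram N D) (F : Filling D N)
    (i : Fin N) : (F.star hD).pos i = starBox D (F.pos i) :=
  rfl

/-- The reflection of a filling reverses its poset, as multiplication by `w₀` does for linear
extensions. -/
theorem mem_linExt_star_iff {D : Finset (ℕ × ℕ)} (hD : IsDiagram (n + 1) D)
    (F : Filling D (n + 1)) :
    σ ∈ linExt (F.star hD).poset ↔ w0 Set.univ * σ ∈ linExt F.poset := by
  change (∀ i j, (F.star hD).pos i ≤ (F.star hD).pos j → σ i ≤ σ j) ↔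
    ∀ i j, F.pos i ≤ F.pos j →
      (w0 Set.univ * σ : Equiv.Perm (Fin (n + 1))) i ≤ (w0 Set.univ * σ : Equiv.Perm (Fin (n + 1))) j
  rw [forall_comm]
  refine forall₂_congr fun i j => ?_
  have h : starBox D (F.pos j) ≤ starBox D (F.pos i) ↔ F.pos i ≤ F.pos j :=
    starBox_le_iff hD (F.symm j).2 (F.symm i).2
  rw [Filling.pos_star, Filling.pos_star, h,
    Equiv.Perm.mul_apply, Equiv.Perm.mul_apply, w0_univ_apply, w0_univ_apply, Fin.rev_le_rev]

end Duality

end WeakBruhat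

/-! ### Extremal elements of the classes of descent intervals -/

theorem mainTheorem3 (n : ℕ) (S : Set (Fin n)) (ρ σ : Equiv.Perm (Fin (n + 1)))
    (hρ : WeakBruhat.leftWeakLE (WeakBruhat.w0 S) ρ)
    (hσ : WeakBruhat.leftWeakLE σ (WeakBruhat.w1 S)) :
    -- the class of `[w₀(S), ρ]_L`
    (IsLeast (WeakBruhat.WeakInterval.eqClass ⟨WeakBruhat.w0 S, ρ, hρ⟩)
        ⟨WeakBruhat.w0 S, ρ, hρ⟩ ∧
      ∃ (hD : WeakBruhat.IsDiagram (n + 1) (WeakBruhat.lowerDiagram S ρ))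
        (M : WeakBruhat.WeakInterval n),
        M.carrier = WeakBruhat.linExt
          (WeakBruhat.fillNE (WeakBruhat.lowerDiagram S ρ) hD.card_eq).poset ∧
        IsGreatest (WeakBruhat.WeakInterval.eqClass ⟨WeakBruhat.w0 S, ρ, hρ⟩) M) ∧
    -- the class of `[σ, w₁(S)]_L`
    ((∃ (hD : WeakBruhat.IsDiagram (n + 1)
            (WeakBruhat.lowerDiagram Sᶜ (WeakBruhat.w0 Set.univ * σ)))
        (M : WeakBruhat.WeakInterval n),
        M.carrier = WeakBruhat.linExt
          (WeakBruhat.Filling.star hD (WeakBruhat.fillNE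
            (WeakBruhat.lowerDiagram Sᶜ (WeakBruhat.w0 Set.univ * σ)) hD.card_eq)).poset ∧
        IsLeast (WeakBruhat.WeakInterval.eqClass ⟨σ, WeakBruhat.w1 S, hσ⟩) M) ∧
      IsGreatest (WeakBruhat.WeakInterval.eqClass ⟨σ, WeakBruhat.w1 S, hσ⟩)
        ⟨σ, WeakBruhat.w1 S, hσ⟩) := by
  refine ⟨⟨WeakBruhat.isLeast_eqClass_lower hρ, WeakBruhat.isDiagram_lowerDiagram hρ,
    WeakBruhat.exists_isGreatest_eqClass_lower hρ (WeakBruhat.isDiagram_lowerDiagram hρ)⟩, ?_⟩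
  -- The second part follows from the first one for the interval `[w₀(Sᶜ), w₀ σ]_L`, which is the
  -- dual of `[σ, w₁(S)]_L`.
  have htop : WeakBruhat.w0 Set.univ * WeakBruhat.w1 S = WeakBruhat.w0 Sᶜ := by
    rw [WeakBruhat.w1_eq, ← mul_assoc, WeakBruhat.w0_univ_mul_self, one_mul]
  have hσ' : WeakBruhat.leftWeakLE (WeakBruhat.w0 Sᶜ) (WeakBruhat.w0 Set.univ * σ) := by
    rw [← htop]
    exact WeakBruhat.leftWeakLE_w0_univ_mul hσ
  set I : WeakBruhat.WeakInterval n := ⟨σ, WeakBruhat.w1 S, hσ⟩ with hI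
  have hdual : I.dual = ⟨WeakBruhat.w0 Sᶜ, WeakBruhat.w0 Set.univ * σ, hσ'⟩ :=
    WeakBruhat.WeakInterval.ext htop rfl
  have hleast := WeakBruhat.isLeast_eqClass_lower hσ'
  have hD := WeakBruhat.isDiagram_lowerDiagram hσ'
  obtain ⟨M, hM, hgreatest⟩ := WeakBruhat.exists_isGreatest_eqClass_lower hσ' hD
  rw [← hdual] at hleast hgreatest
  refine ⟨⟨hD, M.dual, ?_, ?_, fun J hJ => ?_⟩, I.self_mem_eqClass, fun J hJ => ?_⟩
  · ext γ
    rw [WeakBruhat.WeakInterval.mem_carrier_dual_iff, hM, WeakBruhat.mem_linExt_star_iff]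
  · rw [← I.dual_dual]
    exact WeakBruhat.WeakInterval.dual_mem_eqClass hgreatest.1
  · have hJ' := WeakBruhat.WeakInterval.dual_mem_eqClass hJ
    rw [← J.dual_dual]
    exact WeakBruhat.WeakInterval.dual_le_dual hJ' hgreatest.1 (hgreatest.2 hJ')
  · have hJ' := WeakBruhat.WeakInterval.dual_mem_eqClass hJ
    rw [← J.dual_dual, ← I.dual_dual]
    exact WeakBruhat.WeakInterval.dual_le_dual hleast.1 hJ' (hleast.2 hJ')
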